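/- Let $\Sigma$ be a fixed finite alphabet and let $\lambda$ denote the empty word. *Patterns* are given by $P ::= \varepsilon \mid \sigma \mid P_1+P_2 \mid P_1\cdot P_2 \mid P_1^*$ with $\sigma\in\Sigma$. *Nodes* are words over $\{1,2\}$; the nodes of a pattern $P$ are the addresses in its syntax tree (the root is $\lambda$, the children of $n$ are $n1$ and $n2$), and a node of $P$ is *bindable* if none of its proper ancestors is labelled $*$. Write $\mathrm{bn}(P)$ for the set of bindable nodes. An *association* for $P$ is a map $V$ from $\mathrm{bn}(P)$ to $\Sigma^*\cup\{\bot\}$. Write $[\lambda\to w]$ for the map with domain $\{\lambda\}$ and value $w$. Define $V_1+P_2$ by $\lambda\mapsto V_1(\lambda)$, $1n\mapsto V_1(n)$, $2n\mapsto\bot$; define $P_1+V_2$ by $\lambda\mapsto V_2(\lambda)$, $1n\mapsto\bot$, $2n\mapsto V_2(n)$; and define $V_1\cdot V_2$ by $\lambda\mapsto V_1(\lambda)V_2(\lambda)$ (or $\bot$ if one of these is $\bot$), $1n\mapsto V_1(n)$, $2n\mapsto V_2(n)$. The matching relation $w\in P\leadsto V$ and the auxiliary relation $(w_1,w_2)\in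 P_1\cdot P_2\leadsto(V_1,V_2)$ are defined by the following rules, by recursion on patterns, where $w\in P$ means that $w\in P\leadsto V$ for some $V$: - $\lambda\in\varepsilon\leadsto[\lambda\to\lambda]$; $\ \sigma\in\sigma\leadsto[\lambda\to\sigma]$; $\ \lambda\in P^*\leadsto[\lambda\to\lambda]$; - if $w_1\in P\leadsto V_1$, $w_2\in P^*\leadsto V_2$ and $w_1\neq\lambda$, then $w_1w_2\in P^*\leadsto[\lambda\to w_1w_2]$; - if $w\in P_1\leadsto V$, then $w\in P_1+P_2\leadsto V+P_2$; - if $w\in P_2\leadsto V$ and $w\notin P_1$, then $w\in P_1+P_2\leadsto P_1+V$ (first match); - if $(w_1,w_2)\in P_1\cdot P_2\leadsto(V_1,V_2)$, then $w_1w_2\in P_1\cdot P_2\leadsto V_1\cdot V_2$; - if $w\in P\leadsto V_2$, then $(\lambda,w)\in\varepsilon\cdot P\leadsto([\lambda\to\lambda],V_2)$; - if $\sigma\in\sigma\leadsto V_1$ and $w\in P\leadsto V_2$, then $(\sigma,w)\in\sigma\cdot P\leadsto(V_1,V_2)$; - if $(w_1,w_2)\in P_1\cdot P_3\leadsto(V_1,V_2)$,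 then $(w_1,w_2)\in(P_1+P_2)\cdot P_3\leadsto(V_1+P_2,V_2)$; - if $(w_1,w_2)\in P_2\cdot P_3\leadsto(V_1,V_2)$ and $w_1w_2\notin P_1\cdot P_3$, then $(w_1,w_2)\in(P_1+P_2)\cdot P_3\leadsto(P_1+V_1,V_2)$ (first match); - if $(w_1,w_2w_3)\in P_1\cdot(P_2\cdot P_3)\leadsto(V_1,W)$ and $(w_2,w_3)\in P_2\cdot P_3\leadsto(V_2,V_3)$, then $(w_1w_2,w_3)\in(P_1\cdot P_2)\cdot P_3\leadsto(V_1\cdot V_2,V_3)$; - if $w_1\in P_1^*\leadsto V_1$, $w_2\in P_2\leadsto V_2$, and there are no $w_3\neq\lambda$ and $w_4$ with $w_2=w_3w_4$, $w_1w_3\in P_1^*$ and $w_4\in P_2$, then $(w_1,w_2)\in P_1^*\cdot P_2\leadsto(V_1,V_2)$ (longest match). For a language $C\subseteq\Sigma^*$, a pattern $P$ and $n\in\mathrm{bn}(P)$, the *type* of $n$ in $P$ relative to $C$ is $$T(n,P,C)=\{\,w\in\Sigma^* \mid \text{there are } w'\in C \text{ and } V \text{ with } w'\in P\leadsto V \text{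 and } V(n)=w\,\}.$$ **Theorem.** If $C$ is regular, then $T(n,P,C)$ is regular for every pattern $P$ and every bindable node $n$ of $P$. Moreover it can be effectively computed: there is an algorithm (a computable function) that, given $P$, $n\in\mathrm{bn}(P)$ and a finite automaton recognizing $C$, outputs a finite automaton recognizing $T(n,P,C)$. -/

import Mathlib

namespace UniqueMatching

/-- Regular expression patterns over the alphabet `α`. -/
inductive Pattern (α : Type*) where
  | eps : Pattern α
  | sym (a : α) : Pattern α
  | alt (P₁ P₂ : Pattern α) : Pattern α
  | cat (P₁ P₂ : Pattern α) : Pattern α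
  | star (P₁ : Pattern α) : Pattern α

/-- The node labels `{*, ·, +, ε} ∪ α`. -/
inductive Label (α : Type*) where
  | star : Label α
  | cat : Label α
  | alt : Label α
  | eps : Label α
  | sym (a : α) : Label α

/-- Nodes are words over `{1, 2}`; `false` stands for `1` (first child) and `true` for `2`
(second child). -/
abbrev Node := List Bool

namespace Pattern

variable {α : Type*}

/-- The pattern as a partial function from nodes to labels (its abstract syntax tree);
`none` means undefined. -/
def label : Pattern α → Node → Option (Label α)
  | eps, [] => some Label.eps
  | sym a, [] => some (Label.sym a)
  | alt _ _, [] => some Label.alt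
  | alt P₁ _, false :: n => P₁.label n
  | alt _ P₂, true :: n => P₂.label n
  | cat _ _, [] => some Label.cat
  | cat P₁ _, false :: n => P₁.label n
  | cat _ P₂, true :: n => P₂.label n
  | star _, [] => some Label.star
  | star P₁, false :: n => P₁.label n
  | _, _ => none

/-- The set of nodes of the syntax tree. -/
def dom (P : Pattern α) : Set Node := {n | (P.label n).isSome}

/-- Bindable nodes: nodes without a (proper) ancestor labelled `*`. -/
def bn (P : Pattern α) : Set Node :=
  {m | m ∈ P.dom ∧ ∀ n n' : Node, n' ≠ [] → m = n ++ n' → P.label n ≠ some Label.star}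

/-- The number of nodes of the syntax tree. -/
def size : Pattern α → ℕ
  | eps => 1
  | sym _ => 1
  | alt P₁ P₂ => P₁.size + P₂.size + 1
  | cat P₁ P₂ => P₁.size + P₂.size + 1
  | star P₁ => P₁.size + 1

/-- The pattern written as a string of labels in prefix (Polish) notation. -/
def code : Pattern α → List (Label α)
  | eps => [Label.eps]
  | sym a => [Label.sym a]
  | alt P₁ P₂ => Label.alt :: (P₁.code ++ P₂.code)
  | cat P₁ P₂ => Label.cat :: (P₁.code ++ P₂.code)
  | star P₁ => Label.star :: P₁.code

end Pattern

/-- Associations: functions from nodes to words or `⊥` (`none`). An association for a pattern `P`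
is a function on the bindable nodes of `P`; it is extended by `⊥` to all other nodes. -/
abbrev Assoc (α : Type*) := Node → Option (List α)

namespace Assoc

variable {α : Type*}

/-- `[λ → w]`. -/
def single (w : List α) : Assoc α
  | [] => some w
  | _ :: _ => none

/-- `V + P₂`. -/
def altLeft (V : Assoc α) : Assoc α
  | [] => V []
  | false :: n => V n
  | true :: _ => none

/-- `P₁ + V`. -/
def altRight (V : Assoc α) : Assoc α
  | [] => V []
  | false :: _ => none
  | true :: n => V n

/-- `V₁ · V₂`. -/
def cat (V₁ V₂ : Assoc α) : Assoc α
  | [] =>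
    match V₁ [], V₂ [] with
    | some w₁, some w₂ => some (w₁ ++ w₂)
    | _, _ => none
  | false :: n => V₁ n
  | true :: n => V₂ n

end Assoc

/-- The two rules (empty word, closure) for matching against `P*`, where `R` is the matching
relation of `P`. -/
inductive StarMatch {α : Type*} (R : List α → Assoc α → Prop) : List α → Assoc α → Prop
  | empty : StarMatch R [] (Assoc.single [])
  | closure {w₁ w₂ : List α} {V₁ V₂ : Assoc α} :
      R w₁ V₁ → StarMatch R w₂ V₂ → w₁ ≠ [] → StarMatch R (w₁ ++ w₂) (Assoc.single (w₁ ++ w₂))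

/- The matching relation with first match and longest match policy. The inference rules have
negative premises, which only concern smaller patterns; so the relation is defined by recursion on
the pattern, with one clause (or disjunct) for each rule. -/
mutual

/-- `Match P w V`: the word `w` is matched by `P`, yielding the associations `V`. -/
def Match {α : Type*} : Pattern α → List α → Assoc α → Prop
  | .eps => fun w V => w = [] ∧ V = Assoc.single []
  | .sym a => fun w V => w = [a] ∧ V = Assoc.single [a]
  | .star P => StarMatch (fun w V => Match P w V)
  | .alt P₁ P₂ => fun w V =>
      (∃ V₁, Match P₁ w V₁ ∧ V = V₁.altLeft) ∨
      (∃ V₂, Match P₂ w V₂ ∧ (¬ ∃ U, Match P₁ w U) ∧ V = V₂.altRight)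
  | .cat P₁ P₂ => fun w V =>
      ∃ w₁ w₂ V₁ V₂, MatchPair P₁ P₂ w₁ w₂ V₁ V₂ ∧ w = w₁ ++ w₂ ∧ V = V₁.cat V₂
termination_by P => (P.size, P.size)
decreasing_by all_goals simp [Prod.lex_def, Pattern.size]; try omega

/-- `MatchPair P₁ P₂ w₁ w₂ V₁ V₂`: when `w₁ ++ w₂` is matched by `P₁ · P₂`, the pattern `P₁` is
responsible for `w₁`, yielding `V₁`, and `P₂` is responsible for `w₂`, yielding `V₂`. -/
def MatchPair {α : Type*} :
    Pattern α → Pattern α → List α → List α → Assoc α → Assoc α → Prop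
  | .eps, P => fun w₁ w₂ V₁ V₂ => w₁ = [] ∧ V₁ = Assoc.single [] ∧ Match P w₂ V₂
  | .sym a, P => fun w₁ w₂ V₁ V₂ => w₁ = [a] ∧ Match (.sym a) [a] V₁ ∧ Match P w₂ V₂
  | .alt P₁ P₂, P₃ => fun w₁ w₂ V₁ V₂ =>
      (∃ U, MatchPair P₁ P₃ w₁ w₂ U V₂ ∧ V₁ = U.altLeft) ∨
      (∃ U, MatchPair P₂ P₃ w₁ w₂ U V₂ ∧ (¬ ∃ W, Match (.cat P₁ P₃) (w₁ ++ w₂) W) ∧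
        V₁ = U.altRight)
  | .cat P₁ P₂, P₃ => fun w w₃ V V₃ =>
      ∃ w₁ w₂ V₁ V₂ W, MatchPair P₁ (.cat P₂ P₃) w₁ (w₂ ++ w₃) V₁ W ∧
        MatchPair P₂ P₃ w₂ w₃ V₂ V₃ ∧ w = w₁ ++ w₂ ∧ V = V₁.cat V₂
  | .star P₁, P₂ => fun w₁ w₂ V₁ V₂ =>
      Match (.star P₁) w₁ V₁ ∧ Match P₂ w₂ V₂ ∧
      ¬ ∃ w₃ w₄, w₃ ≠ [] ∧ w₂ = w₃ ++ w₄ ∧ (∃ U, Match (.star P₁) (w₁ ++ w₃) U) ∧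
        (∃ U, Match P₂ w₄ U)
termination_by P₁ P₂ => (P₁.size + P₂.size + 1, P₁.size)
decreasing_by all_goals simp [Prod.lex_def, Pattern.size]; try omega

end

/-- The type of node `n` in `P` relative to the context `C`. -/
def typeOf {α : Type*} (n : Node) (P : Pattern α) (C : Language α) : Language α :=
  {w | ∃ w' ∈ C, ∃ V, Match P w' V ∧ V n = some w}

/-- Explicit finite descriptions of nondeterministic finite automata: the states are named by
natural numbers, and the initial states, the final states and the transitions are listed. -/
structure FinAut (α : Type*) where
  init : List ℕ
  final : List ℕ
  trans : List (ℕ × α × ℕ)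

namespace FinAut

variable {α : Type*}

/-- The described automaton. -/
def toNFA (A : FinAut α) : NFA α ℕ where
  step q a := {q' | (q, a, q') ∈ A.trans}
  start := {q | q ∈ A.init}
  accept := {q | q ∈ A.final}

/-- The language recognized by the automaton. -/
def language (A : FinAut α) : Language α := A.toNFA.accepts

/-- Descriptions of automata are triples of lists. -/
def equivProd (α : Type*) : FinAut α ≃ List ℕ × List ℕ × List (ℕ × α × ℕ) where
  toFun A := (A.init, A.final, A.trans)
  invFun x := ⟨x.1, x.2.1, x.2.2⟩
  left_inv _ := rfl
  right_inv _ := rfl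

instance [Primcodable α] : Primcodable (FinAut α) := Primcodable.ofEquiv _ (equivProd α)

end FinAut

namespace Label

/-- Labels are four special symbols or letters. -/
def equivSum (α : Type*) : Label α ≃ Fin 4 ⊕ α where
  toFun
    | star => .inl 0
    | cat => .inl 1
    | alt => .inl 2
    | eps => .inl 3
    | sym a => .inr a
  invFun
    | .inl 0 => star
    | .inl 1 => cat
    | .inl 2 => alt
    | .inl 3 => eps
    | .inr a => sym a
  left_inv l := by cases l <;> rfl
  right_inv x := by
    rcases x with i | a
    · fin_cases i <;> rfl
    · rfl

instance {α : Type*} [Primcodable α] : Primcodable (Label α) := Primcodable.ofEquiv _ (equivSum α)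

end Label

end UniqueMatching

/-!
Whether and how a pattern `P` matches a prefix of a word, when the rest has to be matched by some
continuation, depends on the continuation only through its language `K`; this turns the matching
relation into a structural recursion on `P`.

All tests in that recursion ask for memberships in languages built from `C`, the letters and the
subpatterns by products and Kleene closures, and for splittings of the given words. Start from a
coloring of words by a finite monoid that recognizes `C`, and refine it repeatedly so as to record
the colors of all factorizations of a word: after a number of refinements that is linear in the size
of `P`, the coloring tells the words in a type from those outside it. So types are regular, and
there is an explicit bound `N` for the number of colors.

Consequently an automaton for the type can be read off from the words of length at most `2 N + 1` in
it. Each of them is bound in the matching of some word in `C` of length at most `4 N + 1`, because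
the context on either side of a factor can be shortened to length `N` without changing its color. A
backtracking matcher that lists all ways to match in order of priority finds these words, and
everything is primitive recursive.
-/

namespace UniqueMatching

open scoped Computability

universe u

variable {α : Type u}

/-! ### Matching with a continuation -/

namespace Pattern

/-- The regular language denoted by a pattern, irrespective of the matching policy. -/
def lang : Pattern α → Language α
  | eps => 1
  | sym a => {[a]}
  | alt P₁ P₂ => P₁.lang + P₂.lang
  | cat P₁ P₂ => P₁.lang * P₂.lang
  | star P => P.lang∗

end Pattern

/-- `w₁ ++ w₂` is split into words of `M` and `K` with the longest possible first word. -/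
def IsLongestSplit (M K : Language α) (w₁ w₂ : List α) : Prop :=
  w₁ ∈ M ∧ w₂ ∈ K ∧ ¬ ∃ w₃ w₄, w₃ ≠ [] ∧ w₂ = w₃ ++ w₄ ∧ w₁ ++ w₃ ∈ M ∧ w₄ ∈ K

theorem exists_isLongestSplit {M K : Language α} {w : List α} (hw : w ∈ M * K) :
    ∃ w₁ w₂, w = w₁ ++ w₂ ∧ IsLongestSplit M K w₁ w₂ := by
  classical
  obtain ⟨a, ha, b, hb, rfl⟩ := hw
  obtain ⟨w₁, w₂, hw, h₁, h₂, hk⟩ := Nat.findGreatest_spec (m := a.length)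
    (n := (a ++ b).length)
    (P := fun k => ∃ w₁ w₂, a ++ b = w₁ ++ w₂ ∧ w₁ ∈ M ∧ w₂ ∈ K ∧ w₁.length = k)
    (by simp) ⟨a, b, rfl, ha, hb, rfl⟩
  refine ⟨w₁, w₂, hw, h₁, h₂, ?_⟩
  rintro ⟨w₃, w₄, hne, rfl, h₃, h₄⟩
  have hle : (w₁ ++ w₃).length ≤ w₁.length := by
    rw [hk]
    exact Nat.le_findGreatest (by simp [hw]) ⟨_, w₄, by simpa using hw, h₃, h₄, rfl⟩
  have hpos := List.length_pos_iff.2 hne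
  rw [List.length_append] at hle
  omega

theorem IsLongestSplit.eq_of_length_le {M K : Language α} {w₁ w₂ w₁' w₂' : List α}
    (h : IsLongestSplit M K w₁ w₂) (h₁ : w₁' ∈ M) (h₂ : w₂' ∈ K) (hw : w₁ ++ w₂ = w₁' ++ w₂')
    (hle : w₁.length ≤ w₁'.length) : w₁ = w₁' ∧ w₂ = w₂' := by
  obtain ⟨c, rfl⟩ : w₁ <+: w₁' :=
    List.prefix_of_prefix_length_le (List.prefix_append w₁ w₂) ⟨w₂', hw.symm⟩ hle
  obtain rfl : w₂ = c ++ w₂' := by simpa using hw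
  obtain rfl : c = [] := of_not_not fun hc => h.2.2 ⟨c, w₂', hc, rfl, h₁, h₂⟩
  simp

theorem IsLongestSplit.unique {M K : Language α} {w₁ w₂ w₁' w₂' : List α}
    (h : IsLongestSplit M K w₁ w₂) (h' : IsLongestSplit M K w₁' w₂')
    (hw : w₁ ++ w₂ = w₁' ++ w₂') : w₁ = w₁' ∧ w₂ = w₂' := by
  rcases le_total w₁.length w₁'.length with hle | hle
  · exact h.eq_of_length_le h'.1 h'.2.1 hw hle
  · exact (h'.eq_of_length_le h.1 h.2.1 hw.symm hle).imp Eq.symm Eq.symm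

/-- `Parse P K w₁ w₂ V`: when `w₁ ++ w₂` is matched by `P` followed by a word of `K`, the pattern
`P` is responsible for `w₁`, yielding `V`. The relation `MatchPair P Q` is the case `K = Q.lang`;
an arbitrary continuation `K` allows structural recursion on `P` alone. -/
def Parse : Pattern α → Language α → List α → List α → Assoc α → Prop
  | .eps, K, w₁, w₂, V => w₁ = [] ∧ V = Assoc.single [] ∧ w₂ ∈ K
  | .sym a, K, w₁, w₂, V => w₁ = [a] ∧ V = Assoc.single [a] ∧ w₂ ∈ K
  | .alt P₁ P₂, K, w₁, w₂, V =>
      (∃ U, Parse P₁ K w₁ w₂ U ∧ V = U.altLeft) ∨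
      (∃ U, Parse P₂ K w₁ w₂ U ∧ w₁ ++ w₂ ∉ P₁.lang * K ∧ V = U.altRight)
  | .cat P₁ P₂, K, w₁, w₂, V =>
      ∃ a b V₁ V₂, Parse P₁ (P₂.lang * K) a (b ++ w₂) V₁ ∧ Parse P₂ K b w₂ V₂ ∧
        w₁ = a ++ b ∧ V = V₁.cat V₂
  | .star P, K, w₁, w₂, V => IsLongestSplit P.lang∗ K w₁ w₂ ∧ V = Assoc.single w₁

theorem Parse.mem {P : Pattern α} {K : Language α} {w₁ w₂ : List α} {V : Assoc α}
    (h : Parse P K w₁ w₂ V) : w₁ ∈ P.lang ∧ w₂ ∈ K := by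
  induction P generalizing K w₁ w₂ V with
  | eps | sym => exact ⟨h.1, h.2.2⟩
  | star P _ => exact ⟨h.1.1, h.1.2.1⟩
  | alt P₁ P₂ ih₁ ih₂ =>
    rcases h with ⟨U, h, -⟩ | ⟨U, h, -⟩
    · exact ⟨.inl (ih₁ h).1, (ih₁ h).2⟩
    · exact ⟨.inr (ih₂ h).1, (ih₂ h).2⟩
  | cat P₁ P₂ ih₁ ih₂ =>
    obtain ⟨a, b, V₁, V₂, h₁, h₂, rfl, -⟩ := h
    exact ⟨Language.append_mem_mul (ih₁ h₁).1 (ih₂ h₂).1, (ih₂ h₂).2⟩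

theorem Parse.append_mem {P : Pattern α} {K : Language α} {w₁ w₂ : List α} {V : Assoc α}
    (h : Parse P K w₁ w₂ V) : w₁ ++ w₂ ∈ P.lang * K :=
  Language.append_mem_mul h.mem.1 h.mem.2

theorem Parse.apply_nil {P : Pattern α} {K : Language α} {w₁ w₂ : List α} {V : Assoc α}
    (h : Parse P K w₁ w₂ V) : V [] = some w₁ := by
  induction P generalizing K w₁ w₂ V with
  | eps | sym => obtain ⟨rfl, rfl, -⟩ := h; rfl
  | star P _ => obtain ⟨-, rfl⟩ := h; rfl
  | alt P₁ P₂ ih₁ ih₂ =>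
    rcases h with ⟨U, h, rfl⟩ | ⟨U, h, -, rfl⟩
    · exact ih₁ (V := U) h
    · exact ih₂ (V := U) h
  | cat P₁ P₂ ih₁ ih₂ =>
    obtain ⟨a, b, V₁, V₂, h₁, h₂, rfl, rfl⟩ := h
    simp [Assoc.cat, ih₁ h₁, ih₂ h₂]

theorem Parse.unique {P : Pattern α} {K : Language α} {w₁ w₂ w₁' w₂' : List α} {V V' : Assoc α}
    (h : Parse P K w₁ w₂ V) (h' : Parse P K w₁' w₂' V') (hw : w₁ ++ w₂ = w₁' ++ w₂') :
    w₁ = w₁' ∧ w₂ = w₂' ∧ V = V' := by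
  induction P generalizing K w₁ w₂ w₁' w₂' V V' with
  | eps | sym =>
    obtain ⟨rfl, rfl, -⟩ := h
    obtain ⟨rfl, rfl, -⟩ := h'
    simpa using hw
  | star P _ =>
    obtain ⟨h, rfl⟩ := h
    obtain ⟨h', rfl⟩ := h'
    obtain ⟨rfl, rfl⟩ := h.unique h' hw
    exact ⟨rfl, rfl, rfl⟩
  | alt P₁ P₂ ih₁ ih₂ =>
    rcases h with ⟨U, h, rfl⟩ | ⟨U, h, hn, rfl⟩ <;>
      rcases h' with ⟨U', h', rfl⟩ | ⟨U', h', hn', rfl⟩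
    · obtain ⟨rfl, rfl, rfl⟩ := ih₁ h h' hw
      exact ⟨rfl, rfl, rfl⟩
    · exact absurd (hw ▸ h.append_mem) hn'
    · exact absurd (hw ▸ h'.append_mem) hn
    · obtain ⟨rfl, rfl, rfl⟩ := ih₂ h h' hw
      exact ⟨rfl, rfl, rfl⟩
  | cat P₁ P₂ ih₁ ih₂ =>
    obtain ⟨a, b, V₁, V₂, h₁, h₂, rfl, rfl⟩ := h
    obtain ⟨a', b', V₁', V₂', h₁', h₂', rfl, rfl⟩ := h'
    obtain ⟨rfl, hb, rfl⟩ := ih₁ h₁ h₁' (by simpa using hw)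
    obtain ⟨rfl, rfl, rfl⟩ := ih₂ h₂ h₂' hb
    exact ⟨rfl, rfl, rfl⟩

theorem exists_parse {P : Pattern α} {K : Language α} {w : List α} (h : w ∈ P.lang * K) :
    ∃ w₁ w₂ V, w = w₁ ++ w₂ ∧ Parse P K w₁ w₂ V := by
  induction P generalizing K w with
  | eps | sym =>
    obtain ⟨a, ha, b, hb, rfl⟩ := h
    exact ⟨a, b, _, rfl, ha, rfl, hb⟩
  | alt P₁ P₂ ih₁ ih₂ =>
    by_cases h₁ : w ∈ P₁.lang * K
    · obtain ⟨w₁, w₂, V, rfl, hV⟩ := ih₁ h₁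
      exact ⟨w₁, w₂, _, rfl, .inl ⟨V, hV, rfl⟩⟩
    · have h₂ : w ∈ P₂.lang * K := by
        rw [Pattern.lang, add_mul] at h
        exact h.resolve_left h₁
      obtain ⟨w₁, w₂, V, rfl, hV⟩ := ih₂ h₂
      exact ⟨w₁, w₂, _, rfl, .inr ⟨V, hV, h₁, rfl⟩⟩
  | cat P₁ P₂ ih₁ ih₂ =>
    rw [Pattern.lang, mul_assoc] at h
    obtain ⟨a, r, V₁, rfl, h₁⟩ := ih₁ h
    obtain ⟨b, w₂, V₂, rfl, h₂⟩ := ih₂ h₁.mem.2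
    exact ⟨a ++ b, w₂, _, by simp, a, b, V₁, V₂, h₁, h₂, rfl, rfl⟩
  | star P _ =>
    obtain ⟨w₁, w₂, rfl, hw⟩ := exists_isLongestSplit h
    exact ⟨w₁, w₂, _, rfl, hw, rfl⟩

theorem exists_parse_one_iff {P : Pattern α} {w : List α} :
    (∃ V, Parse P 1 w [] V) ↔ w ∈ P.lang := by
  constructor
  · rintro ⟨V, h⟩
    exact h.mem.1
  · intro h
    obtain ⟨w₁, w₂, V, rfl, hV⟩ := exists_parse (K := 1) (by rwa [mul_one])
    obtain rfl := (Language.mem_one _).1 hV.mem.2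
    exact ⟨V, by simpa using hV⟩

theorem starMatch_iff {L : Language α} {R : List α → Assoc α → Prop}
    (hR : ∀ w, (∃ V, R w V) ↔ w ∈ L) {w : List α} {V : Assoc α} :
    StarMatch R w V ↔ w ∈ L∗ ∧ V = Assoc.single w := by
  constructor
  · intro h
    induction h with
    | empty => exact ⟨Language.nil_mem_kstar _, rfl⟩
    | closure h₁ _ _ ih =>
      refine ⟨?_, rfl⟩
      rw [← Language.one_add_self_mul_kstar_eq_kstar]
      exact .inr (Language.append_mem_mul ((hR _).1 ⟨_, h₁⟩) ih.1)
  · rintro ⟨h, rfl⟩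
    obtain ⟨S, rfl, hS⟩ := Language.mem_kstar_iff_exists_nonempty.1 h
    clear h
    induction S with
    | nil => exact .empty
    | cons x S ih =>
      obtain ⟨V, hV⟩ := (hR x).2 (hS x List.mem_cons_self).1
      exact .closure hV (ih fun y hy => hS y (List.mem_cons_of_mem x hy))
        (hS x List.mem_cons_self).2

/-- `P` matches exactly the words of its language. -/
def MatchesLang (P : Pattern α) : Prop := ∀ w, (∃ V, Match P w V) ↔ w ∈ P.lang

/-- Matching against `P · Q` parses a prefix by `P`, with continuation `Q.lang`, and matches the
rest against `Q`. -/
def PairParses (P Q : Pattern α) : Prop :=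
  ∀ w₁ w₂ V₁ V₂, MatchPair P Q w₁ w₂ V₁ V₂ ↔ Parse P Q.lang w₁ w₂ V₁ ∧ Match Q w₂ V₂

theorem MatchesLang.cat {P Q : Pattern α} (h : PairParses P Q) (hQ : MatchesLang Q) :
    MatchesLang (.cat P Q) := by
  intro w
  rw [Match]
  constructor
  · rintro ⟨W, a, b, U₁, U₂, hm, rfl, -⟩
    exact ((h _ _ _ _).1 hm).1.append_mem
  · intro hw
    obtain ⟨a, b, U, he, hU⟩ := exists_parse hw
    obtain ⟨V, hV⟩ := (hQ b).2 hU.mem.2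
    exact ⟨_, a, b, U, V, (h _ _ _ _).2 ⟨hU, hV⟩, he, rfl⟩

theorem MatchesLang.match_star_iff {P : Pattern α} (h : MatchesLang P) {w : List α}
    {V : Assoc α} : Match (.star P) w V ↔ w ∈ P.lang∗ ∧ V = Assoc.single w := by
  rw [Match]
  exact starMatch_iff h

theorem MatchesLang.pairParses_eps {Q : Pattern α} (hQ : MatchesLang Q) :
    PairParses .eps Q := by
  intro w₁ w₂ V₁ V₂
  simp only [MatchPair, Parse, ← hQ w₂]
  grind

theorem MatchesLang.pairParses_sym {Q : Pattern α} (hQ : MatchesLang Q) (a : α) :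
    PairParses (.sym a) Q := by
  intro w₁ w₂ V₁ V₂
  simp only [MatchPair, Match, Parse, ← hQ w₂]
  grind

theorem PairParses.alt {P₁ P₂ Q : Pattern α} (hQ : MatchesLang Q) (h₁ : PairParses P₁ Q)
    (h₂ : PairParses P₂ Q) : PairParses (.alt P₁ P₂) Q := by
  intro w₁ w₂ V₁ V₂
  have hcat := MatchesLang.cat h₁ hQ (w₁ ++ w₂)
  simp only [MatchPair, Parse, hcat, h₁ _ _ _ _, h₂ _ _ _ _, Pattern.lang]
  grind

theorem PairParses.cat {P₁ P₂ Q : Pattern α} (hQ : MatchesLang Q)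
    (h₁ : PairParses P₁ (.cat P₂ Q)) (h₂ : PairParses P₂ Q) : PairParses (.cat P₁ P₂) Q := by
  intro w₁ w₂ V₁ V₂
  simp only [MatchPair, Parse, h₁ _ _ _ _, h₂ _ _ _ _, Pattern.lang]
  constructor
  · rintro ⟨a, b, U₁, U₂, W, ⟨hU₁, -⟩, ⟨hU₂, hV₂⟩, rfl, rfl⟩
    exact ⟨⟨a, b, U₁, U₂, hU₁, hU₂, rfl, rfl⟩, hV₂⟩
  · rintro ⟨⟨a, b, U₁, U₂, hU₁, hU₂, rfl, rfl⟩, hV₂⟩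
    obtain ⟨W, hW⟩ := (MatchesLang.cat h₂ hQ _).2 hU₂.append_mem
    exact ⟨a, b, U₁, U₂, W, ⟨hU₁, hW⟩, ⟨hU₂, hV₂⟩, rfl, rfl⟩

theorem PairParses.star {P Q : Pattern α} (hP : MatchesLang P) (hQ : MatchesLang Q) :
    PairParses (.star P) Q := by
  intro w₁ w₂ V₁ V₂
  have hw₂ := hQ w₂
  simp only [MatchPair, Parse, IsLongestSplit, hP.match_star_iff, hQ _]
  grind

theorem matchesLang_and_pairParses (P : Pattern α) :
    MatchesLang P ∧ ∀ Q, MatchesLang Q → PairParses P Q := by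
  induction P with
  | eps =>
    refine ⟨fun w => ?_, fun Q hQ => hQ.pairParses_eps⟩
    simp [Match, Pattern.lang, Language.mem_one]
  | sym a =>
    refine ⟨fun w => ?_, fun Q hQ => hQ.pairParses_sym a⟩
    simp only [Match, Pattern.lang, exists_and_left, exists_eq, and_true]
    rfl
  | star P ih =>
    refine ⟨fun w => ?_, fun Q hQ => .star ih.1 hQ⟩
    simp [ih.1.match_star_iff, Pattern.lang]
  | alt P₁ P₂ ih₁ ih₂ =>
    refine ⟨fun w => ?_, fun Q hQ => .alt hQ (ih₁.2 Q hQ) (ih₂.2 Q hQ)⟩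
    have h₁ := ih₁.1 w
    have h₂ := ih₂.1 w
    simp only [Match, Pattern.lang, Language.mem_add]
    grind
  | cat P₁ P₂ ih₁ ih₂ =>
    exact ⟨.cat (ih₁.2 P₂ ih₂.1) ih₂.1,
      fun Q hQ => .cat hQ (ih₁.2 _ (.cat (ih₂.2 Q hQ) hQ)) (ih₂.2 Q hQ)⟩

theorem match_iff_parse {P : Pattern α} {w : List α} {V : Assoc α} :
    Match P w V ↔ Parse P 1 w [] V := by
  induction P generalizing w V with
  | eps | sym => simp [Match, Parse, Language.mem_one]
  | star P _ =>
    rw [(matchesLang_and_pairParses P).1.match_star_iff, Parse, IsLongestSplit]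
    simp only [Language.mem_one, List.nil_eq, List.append_eq_nil_iff]
    grind
  | alt P₁ P₂ ih₁ ih₂ =>
    simp only [Match, Parse, ih₁, ih₂, exists_parse_one_iff, mul_one, List.append_nil]
  | cat P₁ P₂ _ ih₂ =>
    have hpair := (matchesLang_and_pairParses P₁).2 P₂ (matchesLang_and_pairParses P₂).1
    simp only [Match, Parse, hpair _ _ _ _, ih₂, mul_one, List.append_nil, and_assoc]

/-! ### The factor bound to a node -/

/-- `Locates P K n x u v w`: when `x ++ u ++ v ++ w` is matched by `P` followed by a word of `K`,
the pattern `P` is responsible for `x ++ u ++ v` and its node `n` for the factor `u` standing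
there. -/
def Locates : Pattern α → Language α → Node → List α → List α → List α → List α → Prop
  | P, K, [], x, u, v, w => x = [] ∧ v = [] ∧ ∃ V, Parse P K u w V
  | .alt P₁ _, K, false :: n, x, u, v, w => Locates P₁ K n x u v w
  | .alt P₁ P₂, K, true :: n, x, u, v, w =>
      Locates P₂ K n x u v w ∧ x ++ (u ++ (v ++ w)) ∉ P₁.lang * K
  | .cat P₁ P₂, K, false :: n, x, u, v, w =>
      ∃ c b, v = c ++ b ∧ Locates P₁ (P₂.lang * K) n x u c (b ++ w) ∧ ∃ V, Parse P₂ K b w V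
  | .cat P₁ P₂, K, true :: n, x, u, v, w =>
      ∃ a y, x = a ++ y ∧ (∃ V, Parse P₁ (P₂.lang * K) a (y ++ (u ++ (v ++ w))) V) ∧
        Locates P₂ K n y u v w
  | _, _, _ :: _, _, _, _, _ => False

theorem exists_parse_altLeft_iff {P₁ P₂ : Pattern α} {K : Language α} {n : Node}
    {w₁ w₂ u : List α} :
    (∃ V, Parse (.alt P₁ P₂) K w₁ w₂ V ∧ V (false :: n) = some u) ↔
      ∃ V, Parse P₁ K w₁ w₂ V ∧ V n = some u := by
  constructor
  · rintro ⟨_, ⟨V, hV, rfl⟩ | ⟨V, -, -, rfl⟩, hu⟩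
    · exact ⟨V, hV, hu⟩
    · cases hu
  · rintro ⟨V, hV, hu⟩
    exact ⟨_, .inl ⟨V, hV, rfl⟩, hu⟩

theorem exists_parse_altRight_iff {P₁ P₂ : Pattern α} {K : Language α} {n : Node}
    {w₁ w₂ u : List α} :
    (∃ V, Parse (.alt P₁ P₂) K w₁ w₂ V ∧ V (true :: n) = some u) ↔
      (∃ V, Parse P₂ K w₁ w₂ V ∧ V n = some u) ∧ w₁ ++ w₂ ∉ P₁.lang * K := by
  constructor
  · rintro ⟨_, ⟨V, -, rfl⟩ | ⟨V, hV, hn, rfl⟩, hu⟩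
    · cases hu
    · exact ⟨⟨V, hV, hu⟩, hn⟩
  · rintro ⟨⟨V, hV, hu⟩, hn⟩
    exact ⟨_, .inr ⟨V, hV, hn, rfl⟩, hu⟩

theorem exists_parse_catLeft_iff {P₁ P₂ : Pattern α} {K : Language α} {n : Node}
    {w₁ w₂ u : List α} :
    (∃ V, Parse (.cat P₁ P₂) K w₁ w₂ V ∧ V (false :: n) = some u) ↔
      ∃ a b, w₁ = a ++ b ∧ (∃ V, Parse P₁ (P₂.lang * K) a (b ++ w₂) V ∧ V n = some u) ∧
        ∃ V, Parse P₂ K b w₂ V := by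
  constructor
  · rintro ⟨_, ⟨a, b, V₁, V₂, h₁, h₂, rfl, rfl⟩, hu⟩
    exact ⟨a, b, rfl, ⟨V₁, h₁, hu⟩, V₂, h₂⟩
  · rintro ⟨a, b, rfl, ⟨V₁, h₁, hu⟩, V₂, h₂⟩
    exact ⟨_, ⟨a, b, V₁, V₂, h₁, h₂, rfl, rfl⟩, hu⟩

theorem exists_parse_catRight_iff {P₁ P₂ : Pattern α} {K : Language α} {n : Node}
    {w₁ w₂ u : List α} :
    (∃ V, Parse (.cat P₁ P₂) K w₁ w₂ V ∧ V (true :: n) = some u) ↔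
      ∃ a b, w₁ = a ++ b ∧ (∃ V, Parse P₁ (P₂.lang * K) a (b ++ w₂) V) ∧
        ∃ V, Parse P₂ K b w₂ V ∧ V n = some u := by
  constructor
  · rintro ⟨_, ⟨a, b, V₁, V₂, h₁, h₂, rfl, rfl⟩, hu⟩
    exact ⟨a, b, rfl, ⟨V₁, h₁⟩, V₂, h₂, hu⟩
  · rintro ⟨a, b, rfl, ⟨V₁, h₁⟩, V₂, h₂, hu⟩
    exact ⟨_, ⟨a, b, V₁, V₂, h₁, h₂, rfl, rfl⟩, hu⟩

theorem exists_parse_apply_iff {P : Pattern α} {K : Language α} {n : Node} {w₁ w₂ u : List α} :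
    (∃ V, Parse P K w₁ w₂ V ∧ V n = some u) ↔
      ∃ x v, w₁ = x ++ (u ++ v) ∧ Locates P K n x u v w₂ := by
  induction n generalizing P K w₁ w₂ with
  | nil =>
    simp only [Locates]
    constructor
    · rintro ⟨V, hV, hu⟩
      obtain rfl : w₁ = u := Option.some.inj (hV.apply_nil.symm.trans hu)
      exact ⟨[], [], by simp, rfl, rfl, V, hV⟩
    · rintro ⟨x, v, rfl, rfl, rfl, V, hV⟩
      rw [List.nil_append, List.append_nil]
      exact ⟨V, hV, hV.apply_nil⟩
  | cons d n ih =>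
    cases P with
    | eps | sym | star => simp [Parse, Locates, Assoc.single]
    | alt P₁ P₂ =>
      cases d with
      | false => exact exists_parse_altLeft_iff.trans ih
      | true =>
        rw [exists_parse_altRight_iff, ih]
        simp only [Locates]
        grind
    | cat P₁ P₂ =>
      cases d with
      | false =>
        simp only [exists_parse_catLeft_iff, ih, Locates]
        grind
      | true =>
        simp only [exists_parse_catRight_iff, ih, Locates]
        grind

theorem mem_typeOf_iff {n : Node} {P : Pattern α} {C : Language α} {u : List α} :
    u ∈ typeOf n P C ↔ ∃ x v, x ++ (u ++ v) ∈ C ∧ Locates P 1 n x u v [] := by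
  constructor
  · rintro ⟨w, hw, V, hV, hu⟩
    obtain ⟨x, v, rfl, h⟩ := exists_parse_apply_iff.1 ⟨V, match_iff_parse.1 hV, hu⟩
    exact ⟨x, v, hw, h⟩
  · rintro ⟨x, v, hC, h⟩
    obtain ⟨V, hV, hu⟩ := exists_parse_apply_iff.2 ⟨x, v, rfl, h⟩
    exact ⟨_, hC, V, match_iff_parse.2 hV, hu⟩

/-! ### Colorings of words -/

theorem append_mem_kstar {X : Language α} {m₁ m₂ : List α} (h : m₁ ++ m₂ ∈ X∗) :
    (m₁ ∈ X∗ ∧ m₂ ∈ X∗) ∨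
      ∃ p c d q, m₁ = p ++ c ∧ m₂ = d ++ q ∧ p ∈ X∗ ∧ q ∈ X∗ ∧ c ++ d ∈ X := by
  obtain ⟨L, hL, hX⟩ := Language.mem_kstar.1 h
  clear h
  induction L generalizing m₁ with
  | nil =>
    obtain ⟨rfl, rfl⟩ := List.append_eq_nil_iff.1 hL
    exact .inl ⟨Language.nil_mem_kstar _, Language.nil_mem_kstar _⟩
  | cons x L ih =>
    have hx : x ∈ X := hX x (by simp)
    have hX' : ∀ y ∈ L, y ∈ X := fun y hy => hX y (by simp [hy])
    have hcons : ∀ y, y ∈ X∗ → x ++ y ∈ X∗ := fun y hy => by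
      rw [← Language.one_add_self_mul_kstar_eq_kstar]
      exact .inr (Language.append_mem_mul hx hy)
    rw [List.flatten_cons] at hL
    rcases List.append_eq_append_iff.1 hL with ⟨e, rfl, he⟩ | ⟨e, rfl, he⟩
    · exact .inr ⟨[], m₁, e, L.flatten, rfl, he, Language.nil_mem_kstar _,
        Language.join_mem_kstar hX', hx⟩
    · rcases ih he.symm hX' with ⟨h₁, h₂⟩ | ⟨p, c, d, q, rfl, rfl, hp, hq, hcd⟩
      · exact .inl ⟨hcons _ h₁, h₂⟩
      · exact .inr ⟨x ++ p, c, d, q, by simp, rfl, hcons _ hp, hq, hcd⟩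

/-- A congruence of finite index on words, presented as a map to a finite set of colors, for which
the empty word forms a class of its own. It plays the role of a morphism to a finite monoid. -/
structure Coloring (α : Type u) where
  κ : Type u
  [finite : Finite κ]
  color : List α → κ
  append {u u' v v' : List α} : color u = color u' → color v = color v' →
    color (u ++ v) = color (u' ++ v')
  eq_nil {u : List α} : color u = color [] → u = []

attribute [instance] Coloring.finite

namespace Coloring

/-- The language is a union of classes. -/
def Respects (F : Coloring α) (X : Language α) : Prop :=
  ∀ ⦃u v : List α⦄, F.color u = F.color v → u ∈ X → v ∈ X

theorem respects_one (F : Coloring α) : F.Respects 1 := by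
  rintro u v h rfl
  exact F.eq_nil h.symm

theorem Respects.add {F : Coloring α} {X Y : Language α} (hX : F.Respects X)
    (hY : F.Respects Y) : F.Respects (X + Y) :=
  fun _ _ h hu => hu.imp (hX h) (hY h)

theorem Respects.isRegular {F : Coloring α} {X : Language α} (hX : F.Respects X) :
    X.IsRegular := by
  apply Language.IsRegular.of_finite_range_leftQuotient
  have hsub : Set.range X.leftQuotient ⊆
      Set.range fun c : F.κ => ({v | ∃ u, F.color u = c ∧ u ++ v ∈ X} : Language α) := by
    rintro _ ⟨u, rfl⟩
    refine ⟨F.color u, ?_⟩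
    ext v
    constructor
    · rintro ⟨u', hu, h⟩
      exact hX (F.append hu rfl) h
    · exact fun h => ⟨u, rfl, h⟩
  exact (Set.finite_range _).subset hsub

theorem exists_short (F : Coloring α) {N : ℕ} (hN : Nat.card F.κ ≤ N) (w : List α) :
    ∃ w', F.color w' = F.color w ∧ w'.length ≤ N := by
  induction h : w.length using Nat.strong_induction_on generalizing w with
  | _ k ih =>
    by_cases hk : k ≤ N
    · exact ⟨w, rfl, h.trans_le hk⟩
    · have := Fintype.ofFinite F.κ
      obtain ⟨i, j, hij, he⟩ := Fintype.exists_ne_map_eq_of_card_lt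
        (fun i : Fin (N + 1) => F.color (w.take i))
        (by rw [Fintype.card_fin, ← Nat.card_eq_fintype_card]; omega)
      wlog hlt : i < j generalizing i j
      · exact this j i hij.symm he.symm (lt_of_le_of_ne (not_lt.1 hlt) hij.symm)
      have hlen : (w.take i ++ w.drop j).length < k := by
        have := j.is_le
        have := Fin.lt_def.1 hlt
        simp only [List.length_append, List.length_take, List.length_drop]
        omega
      obtain ⟨w', hw', hl⟩ := ih _ hlen _ rfl
      refine ⟨w', hw'.trans ?_, hl⟩
      rw [F.append he rfl, List.take_append_drop]

/-- The words with colors in `X`. -/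
def wordsOf (F : Coloring α) (X : Set F.κ) : Language α := {w | F.color w ∈ X}

theorem Respects.wordsOf_image {F : Coloring α} {X : Language α} (hX : F.Respects X) :
    F.wordsOf (F.color '' X) = X := by
  ext w
  constructor
  · rintro ⟨x, hx, hxw⟩
    exact hX hxw hx
  · exact fun hw => ⟨w, hw, rfl⟩

/-- The colors of the outer words in the factorizations of `u` into three words, the middle one
in the Kleene closure of the language with colors `X`. For `X = ∅` the middle word is empty. -/
def frames (F : Coloring α) (u : List α) (X : Set F.κ) : Set (F.κ × F.κ) :=
  {p | ∃ a m b, u = a ++ (m ++ b) ∧ m ∈ (F.wordsOf X)∗ ∧ p = (F.color a, F.color b)}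

theorem frames_append_subset (F : Coloring α) {u u' v v' : List α}
    (hu : F.color u = F.color u') (hv : F.color v = F.color v')
    {X : Set F.κ} (hu' : F.frames u X ⊆ F.frames u' X) (hv' : F.frames v X ⊆ F.frames v' X) :
    F.frames (u ++ v) X ⊆ F.frames (u' ++ v') X := by
  rintro _ ⟨a, m, b, he, hm, rfl⟩
  rcases List.append_eq_append_iff.1 he with ⟨a₂, rfl, rfl⟩ | ⟨r, rfl, hr⟩
  · obtain ⟨a', m', b', rfl, hm', hp⟩ := hv' ⟨a₂, m, b, rfl, hm, rfl⟩
    rw [Prod.mk.injEq] at hp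
    exact ⟨u' ++ a', m', b', by simp, hm', Prod.ext (F.append hu hp.1) hp.2⟩
  · rcases List.append_eq_append_iff.1 hr with ⟨b₁, rfl, rfl⟩ | ⟨m₂, rfl, rfl⟩
    · obtain ⟨a', m', b', rfl, hm', hp⟩ := hu' ⟨a, m, b₁, rfl, hm, rfl⟩
      rw [Prod.mk.injEq] at hp
      exact ⟨a', m', b' ++ v', by simp, hm', Prod.ext hp.1 (F.append hp.2 hv)⟩
    · rcases append_mem_kstar hm with ⟨h₁, h₂⟩ | ⟨p, c, d, q, rfl, rfl, hp, hq, hcd⟩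
      · obtain ⟨a', m', e, rfl, hm', hp⟩ := hu' ⟨a, r, [], by simp, h₁, rfl⟩
        obtain ⟨f, n', b', rfl, hn', hq⟩ := hv' ⟨[], m₂, b, rfl, h₂, rfl⟩
        rw [Prod.mk.injEq] at hp hq
        obtain rfl := F.eq_nil hp.2.symm
        obtain rfl := F.eq_nil hq.1.symm
        refine ⟨a', m' ++ n', b', by simp, ?_, Prod.ext hp.1 hq.2⟩
        rw [← kstar_mul_kstar]
        exact Language.append_mem_mul hm' hn'
      · obtain ⟨a', p', c', rfl, hp', hac⟩ := hu' ⟨a, p, c, rfl, hp, rfl⟩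
        obtain ⟨d', q', b', rfl, hq', hdb⟩ := hv' ⟨d, q, b, by simp, hq, rfl⟩
        rw [Prod.mk.injEq] at hac hdb
        refine ⟨a', p' ++ ((c' ++ d') ++ q'), b', by simp, ?_, Prod.ext hac.1 hdb.2⟩
        rw [← kstar_mul_kstar, ← Language.one_add_self_mul_kstar_eq_kstar]
        refine Language.append_mem_mul ?_ (.inr (Language.append_mem_mul ?_ hq'))
        · rwa [Language.one_add_self_mul_kstar_eq_kstar]
        · change F.color (c' ++ d') ∈ X
          rwa [← F.append hac.2 hdb.1]

/-- The refinement of a coloring that also records the colors of the parts of all factorizations of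
a word; it respects products and Kleene closures of languages respected by the given coloring. -/
def refine (F : Coloring α) : Coloring α where
  κ := F.κ × (Set F.κ → Set (F.κ × F.κ))
  color u := (F.color u, F.frames u)
  append {u u' v v'} hu hv := by
    rw [Prod.mk.injEq] at hu hv ⊢
    refine ⟨F.append hu.1 hv.1, funext fun X => Set.Subset.antisymm ?_ ?_⟩
    · exact F.frames_append_subset hu.1 hv.1 (by rw [hu.2]) (by rw [hv.2])
    · exact F.frames_append_subset hu.1.symm hv.1.symm (by rw [hu.2]) (by rw [hv.2])
  eq_nil h := F.eq_nil (Prod.mk.injEq .. ▸ h).1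

theorem color_eq_of_refine {F : Coloring α} {u v : List α}
    (h : F.refine.color u = F.refine.color v) : F.color u = F.color v :=
  congrArg Prod.fst h

theorem exists_factorization {F : Coloring α} {X : Language α} (hX : F.Respects X)
    {a m b v : List α} (h : F.refine.color (a ++ (m ++ b)) = F.refine.color v) (hm : m ∈ X∗) :
    ∃ a' m' b', v = a' ++ (m' ++ b') ∧ m' ∈ X∗ ∧ F.color a = F.color a' ∧
      F.color b = F.color b' := by
  have hf : F.frames (a ++ (m ++ b)) = F.frames v := congrArg Prod.snd h
  have hmem : (F.color a, F.color b) ∈ F.frames (a ++ (m ++ b)) (F.color '' X) :=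
    ⟨a, m, b, rfl, by rwa [hX.wordsOf_image], rfl⟩
  rw [hf] at hmem
  obtain ⟨a', m', b', rfl, hm', hp⟩ := hmem
  rw [Prod.mk.injEq] at hp
  exact ⟨a', m', b', rfl, hX.wordsOf_image ▸ hm', hp⟩

theorem exists_split {F : Coloring α} {a b v : List α}
    (h : F.refine.color (a ++ b) = F.refine.color v) :
    ∃ a' b', v = a' ++ b' ∧ F.color a = F.color a' ∧ F.color b = F.color b' := by
  obtain ⟨a', m', b', rfl, hm, ha, hb⟩ := exists_factorization (F := F) (X := 0) (m := [])
    (fun _ _ _ hu => hu) h (Language.nil_mem_kstar _)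
  rw [kstar_zero] at hm
  obtain rfl := (Language.mem_one _).1 hm
  exact ⟨a', b', rfl, ha, hb⟩

theorem Respects.mul {F : Coloring α} {X Y : Language α} (hX : F.Respects X)
    (hY : F.Respects Y) : F.refine.Respects (X * Y) := by
  rintro _ v h ⟨a, ha, b, hb, rfl⟩
  obtain ⟨a', b', rfl, ha', hb'⟩ := exists_split h
  exact Language.append_mem_mul (hX ha' ha) (hY hb' hb)

theorem Respects.kstar {F : Coloring α} {X : Language α} (hX : F.Respects X) :
    F.refine.Respects X∗ := by
  intro u v h hu
  obtain ⟨a', m', b', rfl, hm, ha, hb⟩ :=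
    exists_factorization (a := []) (m := u) (b := []) hX (by simpa using h) hu
  obtain rfl := F.eq_nil ha.symm
  obtain rfl := F.eq_nil hb.symm
  simpa using hm

/-- The coloring after `k` refinements. -/
def level (F : Coloring α) (k : ℕ) : Coloring α := refine^[k] F

theorem level_succ (F : Coloring α) (k : ℕ) : F.level (k + 1) = (F.level k).refine :=
  Function.iterate_succ_apply' ..

/-- The words `u` and `v` are not distinguished after `k` refinements. -/
def Sim (F : Coloring α) (k : ℕ) (u v : List α) : Prop :=
  (F.level k).color u = (F.level k).color v

variable {F : Coloring α} {j k l : ℕ}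

theorem Sim.mono {u v : List α} (h : F.Sim k u v) (hjk : j ≤ k) : F.Sim j u v := by
  induction k, hjk using Nat.le_induction with
  | base => exact h
  | succ k _ ih =>
    rw [Sim, level_succ] at h
    exact ih (color_eq_of_refine h)

theorem Sim.symm {u v : List α} (h : F.Sim k u v) : F.Sim k v u :=
  Eq.symm h

theorem Sim.append {u u' v v' : List α} (hu : F.Sim k u u') (hv : F.Sim k v v') :
    F.Sim k (u ++ v) (u' ++ v') :=
  (F.level k).append hu hv

theorem Sim.eq_nil {u : List α} (h : F.Sim k [] u) : u = [] :=
  (F.level k).eq_nil h.symm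

theorem Sim.exists_split {a b v : List α} (h : F.Sim k (a ++ b) v) (hjk : j < k) :
    ∃ a' b', v = a' ++ b' ∧ F.Sim j a a' ∧ F.Sim j b b' := by
  have h := h.mono hjk
  rw [Sim, level_succ] at h
  exact Coloring.exists_split h

theorem Respects.mono {X : Language α} (hX : (F.level j).Respects X) (hjk : j ≤ k) :
    (F.level k).Respects X :=
  fun _ _ (h : F.Sim k _ _) => hX (h.mono hjk)

theorem Respects.mul_of_lt {X Y : Language α} (hX : (F.level j).Respects X)
    (hY : (F.level j).Respects Y) (hjk : j < k) : (F.level k).Respects (X * Y) := by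
  refine Respects.mono (j := j + 1) ?_ hjk
  rw [level_succ]
  exact hX.mul hY

theorem Respects.kstar_of_lt {X : Language α} (hX : (F.level j).Respects X) (hjk : j < k) :
    (F.level k).Respects X∗ := by
  refine Respects.mono (j := j + 1) ?_ hjk
  rw [level_succ]
  exact hX.kstar

theorem respects_lang (hF : ∀ a, F.Respects {[a]}) (P : Pattern α) (hk : P.size ≤ k) :
    (F.level k).Respects P.lang := by
  induction P generalizing k with
  | eps => exact respects_one _
  | sym a => exact Respects.mono (j := 0) (hF a) (Nat.zero_le _)
  | alt P₁ P₂ ih₁ ih₂ =>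
    rw [Pattern.size] at hk
    exact (ih₁ (by omega)).add (ih₂ (by omega))
  | cat P₁ P₂ ih₁ ih₂ =>
    rw [Pattern.size] at hk
    exact (ih₁ (k := P₁.size + P₂.size) (by omega)).mul_of_lt (ih₂ (by omega)) (by omega)
  | star P ih => exact (ih le_rfl).kstar_of_lt hk

theorem Respects.lang_mul (hF : ∀ a, F.Respects {[a]}) {P : Pattern α} {K : Language α}
    (hK : (F.level j).Respects K) (hP : P.size ≤ j) (hjk : j < k) :
    (F.level k).Respects (P.lang * K) :=
  (respects_lang hF P hP).mul_of_lt hK hjk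

theorem Sim.isLongestSplit {M K : Language α} {w₁ w₂ w₁' w₂' : List α}
    (hM : (F.level k).Respects M) (hK : (F.level k).Respects K) (hkl : k < l)
    (h₁ : F.Sim l w₁ w₁') (h₂ : F.Sim l w₂ w₂') (h : IsLongestSplit M K w₁ w₂) :
    IsLongestSplit M K w₁' w₂' := by
  refine ⟨hM.mono hkl.le h₁ h.1, hK.mono hkl.le h₂ h.2.1, ?_⟩
  rintro ⟨w₃', w₄', hne, rfl, h₃', h₄'⟩
  obtain ⟨w₃, w₄, rfl, h₃, h₄⟩ := Sim.exists_split h₂.symm hkl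
  refine h.2.2 ⟨w₃, w₄, ?_, rfl, hM ((h₁.mono hkl.le).symm.append h₃) h₃', hK h₄ h₄'⟩
  rintro rfl
  exact hne (Sim.eq_nil h₃.symm)

theorem Sim.exists_parse (hF : ∀ a, F.Respects {[a]}) {P : Pattern α} {K : Language α}
    (hK : (F.level k).Respects K) (hk : P.size ≤ k) (hkl : k + 2 * P.size ≤ l)
    {w₁ w₂ w₁' w₂' : List α} (h₁ : F.Sim l w₁ w₁') (h₂ : F.Sim l w₂ w₂')
    (h : ∃ V, Parse P K w₁ w₂ V) : ∃ V, Parse P K w₁' w₂' V := by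
  obtain ⟨V, h⟩ := h
  induction P generalizing K k l w₁ w₂ w₁' w₂' V with
  | eps =>
    obtain ⟨rfl, -, h⟩ := h
    exact ⟨_, h₁.eq_nil, rfl, hK.mono (by omega) h₂ h⟩
  | sym a =>
    obtain ⟨rfl, -, h⟩ := h
    exact ⟨_, hF a (h₁.mono (Nat.zero_le l)) rfl, rfl, hK.mono (by omega) h₂ h⟩
  | star P _ =>
    have hP := (respects_lang hF P le_rfl).kstar_of_lt hk
    rw [Pattern.size] at hkl
    exact ⟨_, h₁.isLongestSplit hP hK (by omega) h₂ h.1, rfl⟩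
  | alt P₁ P₂ ih₁ ih₂ =>
    rw [Pattern.size] at hk hkl
    rcases h with ⟨U, h, -⟩ | ⟨U, h, hn, -⟩
    · obtain ⟨U', h'⟩ := ih₁ hK (by omega) (by omega) h₁ h₂ U h
      exact ⟨_, .inl ⟨U', h', rfl⟩⟩
    · obtain ⟨U', h'⟩ := ih₂ hK (by omega) (by omega) h₁ h₂ U h
      have hP₁ : (F.level l).Respects (P₁.lang * K) := hK.lang_mul hF (by omega) (by omega)
      exact ⟨_, .inr ⟨U', h', fun hm => hn (hP₁ (h₁.append h₂).symm hm), rfl⟩⟩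
  | cat P₁ P₂ ih₁ ih₂ =>
    rw [Pattern.size] at hk hkl
    obtain ⟨a, b, V₁, V₂, hV₁, hV₂, rfl, -⟩ := h
    obtain ⟨a', b', rfl, ha, hb⟩ := h₁.exists_split (j := l - 1) (by omega)
    have h₂ := h₂.mono (Nat.sub_le l 1)
    have hP₂ : (F.level (k + 1)).Respects (P₂.lang * K) := hK.lang_mul hF (by omega) (by omega)
    obtain ⟨V₁', hV₁'⟩ := ih₁ hP₂ (by omega) (by omega) ha (hb.append h₂) V₁ hV₁
    obtain ⟨V₂', hV₂'⟩ := ih₂ hK (by omega) (by omega) hb h₂ V₂ hV₂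
    exact ⟨_, a', b', V₁', V₂', hV₁', hV₂', rfl, rfl⟩

theorem Sim.locates (hF : ∀ a, F.Respects {[a]}) {P : Pattern α} {K : Language α} {n : Node}
    (hK : (F.level k).Respects K) (hk : P.size ≤ k) (hkl : k + 2 * P.size ≤ l)
    {x u v w x' u' v' w' : List α} (hx : F.Sim l x x') (hu : F.Sim l u u') (hv : F.Sim l v v')
    (hw : F.Sim l w w') (h : Locates P K n x u v w) : Locates P K n x' u' v' w' := by
  induction n generalizing P K k l x u v w x' u' v' w' with
  | nil =>
    simp only [Locates] at h ⊢
    obtain ⟨rfl, rfl, h⟩ := h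
    exact ⟨hx.eq_nil, hv.eq_nil, hu.exists_parse hF hK hk hkl hw h⟩
  | cons d n ih =>
    cases P with
    | eps | sym | star => simp only [Locates] at h
    | alt P₁ P₂ =>
      rw [Pattern.size] at hk hkl
      cases d with
      | false => exact ih (P := P₁) hK (by omega) (by omega) hx hu hv hw h
      | true =>
        have hP₁ : (F.level l).Respects (P₁.lang * K) := hK.lang_mul hF (by omega) (by omega)
        exact ⟨ih hK (by omega) (by omega) hx hu hv hw h.1,
          fun hm => h.2 (hP₁ (hx.append (hu.append (hv.append hw))).symm hm)⟩
    | cat P₁ P₂ =>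
      rw [Pattern.size] at hk hkl
      have hl : l - 1 < l := by omega
      have hP₂ : (F.level (k + 1)).Respects (P₂.lang * K) := hK.lang_mul hF (by omega) (by omega)
      have hu₁ := hu.mono hl.le
      have hw₁ := hw.mono hl.le
      cases d with
      | false =>
        obtain ⟨c, b, rfl, h₁, h₂⟩ := h
        obtain ⟨c', b', rfl, hc, hb⟩ := hv.exists_split hl
        exact ⟨c', b', rfl,
          ih hP₂ (by omega) (by omega) (hx.mono hl.le) hu₁ hc (hb.append hw₁) h₁,
          hb.exists_parse hF hK (by omega) (by omega) hw₁ h₂⟩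
      | true =>
        obtain ⟨a, y, rfl, h₁, h₂⟩ := h
        obtain ⟨a', y', rfl, ha, hy⟩ := hx.exists_split hl
        have hv₁ := hv.mono hl.le
        exact ⟨a', y', rfl,
          ha.exists_parse hF hP₂ (by omega) (by omega)
            (hy.append (hu₁.append (hv₁.append hw₁))) h₁,
          ih hK (by omega) (by omega) hy hu₁ hv₁ hw₁ h₂⟩

theorem respects_typeOf (hF : ∀ a, F.Respects {[a]}) {C : Language α} (hC : F.Respects C)
    (P : Pattern α) (n : Node) : (F.level (3 * P.size)).Respects (typeOf n P C) := by
  intro u u' huu' hu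
  obtain ⟨x, v, hxv, h⟩ := mem_typeOf_iff.1 hu
  have huu' : F.Sim (3 * P.size) u u' := huu'
  exact mem_typeOf_iff.2 ⟨x, v,
    hC (Sim.append (k := 0) rfl ((huu'.mono (Nat.zero_le _)).append rfl)) hxv,
    Sim.locates hF (respects_one _) le_rfl (by omega) rfl huu' rfl rfl h⟩

theorem exists_short_of_mem_typeOf (hF : ∀ a, F.Respects {[a]}) {C : Language α}
    (hC : F.Respects C) {P : Pattern α} {n : Node} {N : ℕ}
    (hN : Nat.card (F.level (3 * P.size)).κ ≤ N) {u : List α} (h : u ∈ typeOf n P C) :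
    ∃ w ∈ C, w.length ≤ u.length + 2 * N ∧ ∃ V, Parse P 1 w [] V ∧ V n = some u := by
  obtain ⟨x, v, hxv, h⟩ := mem_typeOf_iff.1 h
  obtain ⟨x', hx, hlx⟩ := exists_short _ hN x
  obtain ⟨v', hv, hlv⟩ := exists_short _ hN v
  have hx : F.Sim (3 * P.size) x x' := hx.symm
  have hv : F.Sim (3 * P.size) v v' := hv.symm
  refine ⟨x' ++ (u ++ v'), ?_, by simp only [List.length_append]; omega, ?_⟩
  · exact hC ((hx.mono (Nat.zero_le _)).append (Sim.append rfl (hv.mono (Nat.zero_le _)))) hxv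
  · exact exists_parse_apply_iff.2 ⟨x', v', rfl,
      Sim.locates hF (respects_one _) le_rfl (by omega) hx rfl hv rfl h⟩

/-- The first two letters of a word, as far as they serve to tell the words of length at most one
from each other and from all other words. -/
def initial : List α → Option (Option α)
  | [] => none
  | [a] => some (some a)
  | _ => some none

theorem initial_append {u u' v v' : List α} (hu : initial u = initial u')
    (hv : initial v = initial v') : initial (u ++ v) = initial (u' ++ v') := by
  rcases u with _ | ⟨a, _ | ⟨b, u⟩⟩ <;> rcases u' with _ | ⟨a', _ | ⟨b', u'⟩⟩ <;>
    simp only [initial, reduceCtorEq, Option.some.injEq] at hu <;>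
    rcases v with _ | ⟨c, _ | ⟨d, v⟩⟩ <;> rcases v' with _ | ⟨c', _ | ⟨d', v'⟩⟩ <;>
    simp only [initial, reduceCtorEq, Option.some.injEq] at hv <;>
    simp [initial, hu, hv]

/-- The coloring of words by the transformations of the states of an automaton, made finer so as to
respect the empty word and the single letters. -/
def ofDFA {σ : Type} [Finite σ] [Finite α] (M : DFA α σ) : Coloring α where
  κ := Option (Option α) × (σ → σ)
  color u := (initial u, fun s => M.evalFrom s u)
  append {u u' v v'} hu hv := by
    simp only [Prod.mk.injEq, funext_iff, DFA.evalFrom_of_append] at hu hv ⊢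
    exact ⟨initial_append hu.1 hv.1, fun s => by rw [hu.2, hv.2]⟩
  eq_nil {u} h := by
    have h₁ := congrArg Prod.fst h
    rcases u with _ | ⟨_, _ | _⟩ <;> simp_all [initial]

theorem ofDFA_respects_singleton {σ : Type} [Finite σ] [Finite α] (M : DFA α σ) (a : α) :
    (ofDFA M).Respects {[a]} := by
  rintro u v h rfl
  have h₁ : initial [a] = initial v := congrArg Prod.fst h
  rcases v with _ | ⟨_, _ | _⟩ <;> simp_all [initial]
  rfl

theorem ofDFA_respects_accepts {σ : Type} [Finite σ] [Finite α] (M : DFA α σ) :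
    (ofDFA M).Respects M.accepts := by
  intro u v h hu
  have h₁ : M.evalFrom M.start u = M.evalFrom M.start v := congrFun (congrArg Prod.snd h) _
  change M.evalFrom M.start u ∈ M.accept at hu
  change M.evalFrom M.start v ∈ M.accept
  rwa [← h₁]

end Coloring

theorem isRegular_typeOf [Finite α] (P : Pattern α) (n : Node) {C : Language α}
    (hC : C.IsRegular) : (typeOf n P C).IsRegular := by
  obtain ⟨σ, _, M, rfl⟩ := hC
  exact (Coloring.respects_typeOf (Coloring.ofDFA_respects_singleton M)
    (Coloring.ofDFA_respects_accepts M) P n).isRegular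

/-- A bound for the number of colors after a refinement. -/
def refineCard (n : ℕ) : ℕ := n * (2 ^ (n * n)) ^ 2 ^ n

theorem Coloring.card_level (F : Coloring α) (k : ℕ) :
    Nat.card (F.level k).κ = refineCard^[k] (Nat.card F.κ) := by
  induction k with
  | zero => rfl
  | succ k ih =>
    rw [level_succ, Function.iterate_succ_apply', ← ih]
    have h : ∀ κ : Type u, [Finite κ] →
        Nat.card (κ × (Set κ → Set (κ × κ))) = refineCard (Nat.card κ) := by
      intro κ _
      have := Fintype.ofFinite κ
      classical
      simp [refineCard]
    exact h _

/-! ### Lists of successes -/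

/-- The words of length at most `n` over the listed letters, longest words first. -/
def words (letters : List α) : ℕ → List (List α)
  | 0 => [[]]
  | n + 1 => (words letters n).flatMap (fun w => letters.map (· :: w)) ++ [[]]

theorem mem_words {letters : List α} (hl : ∀ a, a ∈ letters) {n : ℕ} {w : List α} :
    w ∈ words letters n ↔ w.length ≤ n := by
  induction n generalizing w with
  | zero => simp [words]
  | succ n ih => cases w <;> simp [words, ih, hl]

theorem pairwise_words (letters : List α) (n : ℕ) :
    (words letters n).Pairwise fun v w => w.length ≤ v.length := by
  induction n with
  | zero => simp [words]
  | succ n ih =>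
    refine List.pairwise_append.2 ⟨List.pairwise_flatMap.2 ⟨?_, ih.imp ?_⟩, by simp, by simp⟩
    · intro w _
      exact List.pairwise_map.2 (List.pairwise_of_forall fun _ _ => le_rfl)
    · simp +contextual

/-- The concatenations of fewer than `k` listed words. -/
def concatWords (L : List (List α)) (k : ℕ) : List (List α) :=
  (fun S => [] :: S.flatMap fun w => L.map (· ++ w))^[k] []

theorem concatWords_succ (L : List (List α)) (k : ℕ) :
    concatWords L (k + 1) = [] :: (concatWords L k).flatMap fun w => L.map (· ++ w) :=
  Function.iterate_succ_apply' ..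

theorem mem_kstar_of_mem_concatWords {M : Language α} {L : List (List α)} (hL : ∀ x ∈ L, x ∈ M)
    {k : ℕ} {w : List α} (hw : w ∈ concatWords L k) : w ∈ M∗ := by
  induction k generalizing w with
  | zero => simp [concatWords] at hw
  | succ k ih =>
    simp only [concatWords_succ, List.mem_cons, List.mem_flatMap, List.mem_map] at hw
    rcases hw with rfl | ⟨v, hv, x, hx, rfl⟩
    · exact Language.nil_mem_kstar _
    · rw [← Language.one_add_self_mul_kstar_eq_kstar]
      exact .inr (Language.append_mem_mul (hL x hx) (ih hv))

theorem mem_concatWords {M : Language α} {L : List (List α)} {k : ℕ} {w : List α}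
    (hL : ∀ x ∈ M, x.length ≤ w.length → x ∈ L) (hw : w ∈ M∗) (hk : w.length < k) :
    w ∈ concatWords L k := by
  obtain ⟨S, rfl, hS⟩ := Language.mem_kstar_iff_exists_nonempty.1 hw
  clear hw
  induction S generalizing k with
  | nil =>
    obtain ⟨k, rfl⟩ := Nat.exists_eq_add_of_lt hk
    simp [concatWords_succ]
  | cons x S ih =>
    obtain ⟨k, rfl⟩ := Nat.exists_eq_add_of_lt hk
    have hx := hS x List.mem_cons_self
    have hpos := List.length_pos_iff.2 hx.2
    rw [List.flatten_cons, List.length_append] at hL ⊢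
    rw [concatWords_succ]
    refine List.mem_cons_of_mem _ (List.mem_flatMap.2 ⟨S.flatten, ?_, List.mem_map.2 ⟨x, ?_, rfl⟩⟩)
    · exact ih (fun y hy => hS y (List.mem_cons_of_mem x hy)) (fun y hy hle => hL y hy (by omega))
        (by omega)
    · exact hL x hx.1 (by omega)

theorem find?_eq_some_of_pairwise {β : Type*} {R : β → β → Prop} {p : β → Bool} {T : List β}
    (hT : T.Pairwise R) {t : β} (ht : t ∈ T) (hp : p t)
    (hR : ∀ t' ∈ T, p t' → R t' t → t' = t) : T.find? p = some t := by
  obtain ⟨s, hs⟩ := Option.isSome_iff_exists.1 (List.find?_isSome.2 ⟨t, ht, hp⟩)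
  obtain ⟨hps, T₁, T₂, rfl, hT₁⟩ := List.find?_eq_some_iff_append.1 hs
  rw [hs]
  rcases List.mem_append.1 ht with ht | ht
  · simpa [hp] using hT₁ t ht
  · rcases List.mem_cons.1 ht with rfl | ht
    · rfl
    · have hst := List.rel_of_pairwise_cons (List.pairwise_append.1 hT).2.1 ht
      rw [hR s (by simp) hps hst]

theorem find?_flatMap_eq {β γ : Type*} {p : γ → Bool} {q : β → Bool} {f : β → List γ}
    {T : List β} {t : β} (ht : T.find? q = some t) {s : γ} (hs : (f t).find? p = some s)
    (hq : ∀ t' ∈ T, ∀ s' ∈ f t', p s' → q t') : (T.flatMap f).find? p = some s := by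
  obtain ⟨-, T₁, T₂, rfl, hT₁⟩ := List.find?_eq_some_iff_append.1 ht
  have hnone : (T₁.flatMap f).find? p = none := by
    simp only [List.find?_eq_none, List.mem_flatMap]
    rintro s' ⟨t', ht', hs'⟩ hps
    have := hT₁ t' ht'
    simp [hq t' (by simp [ht']) s' hs' hps] at this
  simp [List.flatMap_append, List.find?_append, hnone, hs]

/-- One way to match a prefix of a word: the prefix, the rest of the word, and the graph of the
association, as a list of pairs. -/
abbrev Success (α : Type u) := List α × List α × List (Node × List α)

open scoped Classical in
/-- The test for the ways to match a prefix of `w` that leave a rest in `K`. -/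
noncomputable def isSuccess (K : Language α) (w : List α) (t : Success α) : Bool :=
  t.1 ++ t.2.1 = w ∧ t.2.1 ∈ K

theorem isSuccess_iff {K : Language α} {w : List α} {t : Success α} :
    isSuccess K w t ↔ t.1 ++ t.2.1 = w ∧ t.2.1 ∈ K := by
  simp [isSuccess]

theorem find?_map_isSuccess (K : Language α) (w : List α) (T : List (Success α))
    (f : Success α → List (Node × List α)) :
    (T.map fun t => (t.1, t.2.1, f t)).find? (isSuccess K w) =
      (T.find? (isSuccess K w)).map fun t => (t.1, t.2.1, f t) :=
  List.find?_map ..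

/-- The table `T` lists the ways to match prefixes of words by `P`, in order of priority: for every
word of length at most `B` and every continuation language, the first way in the table that is
compatible with both is the one selected by the matching policy. -/
structure IsTable (B : ℕ) (P : Pattern α) (T : List (Success α)) : Prop where
  mem_lang : ∀ t ∈ T, t.1 ∈ P.lang
  find : ∀ ⦃K : Language α⦄ ⦃w₁ w₂ V⦄, Parse P K w₁ w₂ V → (w₁ ++ w₂).length ≤ B →
    ∃ s, T.find? (isSuccess K (w₁ ++ w₂)) = some (w₁, w₂, s) ∧
      ∀ n u, (n, u) ∈ s ↔ V n = some u

/-- The bindings of a node and of the subtrees at its two children, as bindings of one tree. -/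
def nodeBindings (w : List α) (s₁ s₂ : List (Node × List α)) : List (Node × List α) :=
  ([], w) :: (s₁.map (fun b => (false :: b.1, b.2)) ++ s₂.map fun b => (true :: b.1, b.2))

@[simp]
theorem nil_mem_nodeBindings {w u : List α} {s₁ s₂ : List (Node × List α)} :
    ([], u) ∈ nodeBindings w s₁ s₂ ↔ u = w := by
  simp [nodeBindings]

@[simp]
theorem false_cons_mem_nodeBindings {w u : List α} {s₁ s₂ : List (Node × List α)} {n : Node} :
    (false :: n, u) ∈ nodeBindings w s₁ s₂ ↔ (n, u) ∈ s₁ := by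
  simp [nodeBindings]

@[simp]
theorem true_cons_mem_nodeBindings {w u : List α} {s₁ s₂ : List (Node × List α)} {n : Node} :
    (true :: n, u) ∈ nodeBindings w s₁ s₂ ↔ (n, u) ∈ s₂ := by
  simp [nodeBindings]

/-- The table of a pattern that matches the words of `S` without inner structure and prefers those
listed first. -/
def leafTable (U S : List (List α)) : List (Success α) :=
  S.flatMap fun w₁ => U.map fun w₂ => (w₁, w₂, [([], w₁)])

/-- The table of an alternative: everything that the first pattern can do has priority. -/
def altTable (T₁ T₂ : List (Success α)) : List (Success α) :=
  T₁.map (fun t => (t.1, t.2.1, nodeBindings t.1 t.2.2 [])) ++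
    T₂.map (fun t => (t.1, t.2.1, nodeBindings t.1 [] t.2.2))

open scoped Classical in
/-- The table of a concatenation: the second pattern is matched against the rest left by the
first. -/
noncomputable def catTable (T₁ T₂ : List (Success α)) : List (Success α) :=
  T₁.flatMap fun t₁ => (T₂.filter fun t₂ => t₂.1 ++ t₂.2.1 = t₁.2.1).map fun t₂ =>
    (t₁.1 ++ t₂.1, t₂.2.1, nodeBindings (t₁.1 ++ t₂.1) t₁.2.2 t₂.2.2)

open scoped Classical in
/-- The table of a closure. The words matched by the pattern itself are those that are matched with
an empty rest. -/
noncomputable def starTable (B : ℕ) (U : List (List α)) (T : List (Success α)) : List (Success α) :=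
  leafTable U (U.filter (· ∈ concatWords ((T.filter (·.2.1 = [])).map (·.1)) (B + 1)))

theorem find?_leafTable {M K : Language α} {U S : List (List α)}
    (hS : S.Pairwise fun v w => w.length ≤ v.length) (hM : ∀ x ∈ S, x ∈ M) {w₁ w₂ : List α}
    (h : IsLongestSplit M K w₁ w₂) (h₁ : w₁ ∈ S) (h₂ : w₂ ∈ U) :
    (leafTable U S).find? (isSuccess K (w₁ ++ w₂)) = some (w₁, w₂, [([], w₁)]) := by
  have hpair : (leafTable U S).Pairwise fun t t' => t'.1.length ≤ t.1.length := by
    refine List.pairwise_flatMap.2 ⟨fun w _ => ?_, hS.imp ?_⟩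
    · exact List.pairwise_map.2 (List.pairwise_of_forall fun _ _ => le_rfl)
    · intro v w hvw
      simp only [List.mem_map]
      rintro _ ⟨_, -, rfl⟩ _ ⟨_, -, rfl⟩
      exact hvw
  refine find?_eq_some_of_pairwise hpair ?_ (isSuccess_iff.2 ⟨rfl, h.2.1⟩) ?_
  · exact List.mem_flatMap.2 ⟨w₁, h₁, List.mem_map.2 ⟨w₂, h₂, rfl⟩⟩
  · simp only [leafTable, List.mem_flatMap, List.mem_map]
    rintro _ ⟨w₁', h₁', w₂', -, rfl⟩ hp hle
    obtain ⟨hw, hK⟩ := isSuccess_iff.1 hp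
    obtain ⟨rfl, rfl⟩ := h.eq_of_length_le (hM w₁' h₁') hK hw.symm hle
    rfl

theorem isTable_leafTable {P : Pattern α} {B : ℕ} {U S : List (List α)}
    (hU : ∀ w, w.length ≤ B → w ∈ U) (hS : S.Pairwise fun v w => w.length ≤ v.length)
    (hmem : ∀ x ∈ S, x ∈ P.lang)
    (hP : ∀ ⦃K w₁ w₂ V⦄, Parse P K w₁ w₂ V → (w₁ ++ w₂).length ≤ B →
      w₁ ∈ S ∧ IsLongestSplit P.lang K w₁ w₂ ∧ V = Assoc.single w₁) :
    IsTable B P (leafTable U S) where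
  mem_lang := by
    simp only [leafTable, List.mem_flatMap, List.mem_map]
    rintro _ ⟨w₁, hw₁, w₂, -, rfl⟩
    exact hmem w₁ hw₁
  find := by
    intro K w₁ w₂ V hV hB
    obtain ⟨h₁, h, rfl⟩ := hP hV hB
    refine ⟨_, find?_leafTable hS hmem h h₁ (hU w₂ ?_), fun n u => ?_⟩
    · exact (List.length_append ▸ Nat.le_add_left _ _ : w₂.length ≤ (w₁ ++ w₂).length).trans hB
    · cases n <;> simp [Assoc.single, eq_comm]

theorem isTable_eps {B : ℕ} {U : List (List α)} (hU : ∀ w, w.length ≤ B → w ∈ U) :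
    IsTable B .eps (leafTable U [[]]) :=
  isTable_leafTable hU (by simp) (by simp [Pattern.lang]) fun K w₁ w₂ V hV _ => by
    obtain ⟨rfl, rfl, hK⟩ := hV
    exact ⟨by simp, ⟨rfl, hK, fun ⟨_, _, hne, _, h, _⟩ => hne h⟩, rfl⟩

theorem isTable_sym (a : α) {B : ℕ} {U : List (List α)} (hU : ∀ w, w.length ≤ B → w ∈ U) :
    IsTable B (.sym a) (leafTable U [[a]]) :=
  isTable_leafTable hU (by simp) (List.forall_mem_singleton.2 rfl) fun K w₁ w₂ V hV _ => by
    obtain ⟨rfl, rfl, hK⟩ := hV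
    exact ⟨by simp, ⟨rfl, hK, fun ⟨_, _, hne, _, h, _⟩ => hne (List.cons_eq_cons.1 h).2⟩, rfl⟩

namespace IsTable

variable {B : ℕ}

theorem exists_mem {P : Pattern α} {T : List (Success α)} (hT : IsTable B P T) {x : List α}
    (hx : x ∈ P.lang) (hB : x.length ≤ B) : ∃ s, (x, [], s) ∈ T := by
  obtain ⟨w₁, w₂, V, rfl, hV⟩ :=
    exists_parse (K := 1) (by simpa using hx : x ∈ P.lang * 1)
  obtain ⟨s, hs, -⟩ := hT.find hV hB
  obtain rfl : w₂ = [] := hV.mem.2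
  exact ⟨s, by simpa using List.mem_of_find?_eq_some hs⟩

open scoped Classical in
theorem starTable {P : Pattern α} {T : List (Success α)} (hT : IsTable B P T) {letters : List α}
    (hl : ∀ a, a ∈ letters) : IsTable B (.star P) (starTable B (words letters B) T) := by
  refine isTable_leafTable (fun w hw => (mem_words hl).2 hw) ((pairwise_words letters B).filter _)
    (fun x hx => ?_) fun K w₁ w₂ V hV hB => ?_
  · refine mem_kstar_of_mem_concatWords (M := P.lang) (fun y hy => ?_)
      (of_decide_eq_true (List.mem_filter.1 hx).2)
    obtain ⟨t, ht, rfl⟩ := List.mem_map.1 hy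
    exact hT.mem_lang t (List.mem_filter.1 ht).1
  · obtain ⟨h, rfl⟩ := hV
    have hB₁ : w₁.length ≤ B := by rw [List.length_append] at hB; omega
    refine ⟨List.mem_filter.2 ⟨(mem_words hl).2 hB₁, decide_eq_true ?_⟩, h, rfl⟩
    refine mem_concatWords (fun x hx hle => ?_) h.1 (by omega)
    obtain ⟨s, hs⟩ := hT.exists_mem hx (hle.trans hB₁)
    exact List.mem_map.2 ⟨_, List.mem_filter.2 ⟨hs, by simp⟩, rfl⟩

theorem altTable {P₁ P₂ : Pattern α} {T₁ T₂ : List (Success α)} (h₁ : IsTable B P₁ T₁)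
    (h₂ : IsTable B P₂ T₂) : IsTable B (.alt P₁ P₂) (altTable T₁ T₂) where
  mem_lang := by
    simp only [UniqueMatching.altTable, List.mem_append, List.mem_map]
    rintro _ (⟨t, ht, rfl⟩ | ⟨t, ht, rfl⟩)
    · exact .inl (h₁.mem_lang t ht)
    · exact .inr (h₂.mem_lang t ht)
  find := by
    rintro K w₁ w₂ _ (⟨V, hV, rfl⟩ | ⟨V, hV, hn, rfl⟩) hB
    · obtain ⟨s, hs, hsV⟩ := h₁.find hV hB
      refine ⟨_, by rw [UniqueMatching.altTable, List.find?_append, find?_map_isSuccess, hs]; rfl,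
        ?_⟩
      rintro (_ | ⟨_ | _, n⟩) u <;> simp [Assoc.altLeft, hsV, hV.apply_nil, eq_comm]
    · obtain ⟨s, hs, hsV⟩ := h₂.find hV hB
      have hnone : T₁.find? (isSuccess K (w₁ ++ w₂)) = none := by
        refine List.find?_eq_none.2 fun t ht hp => hn ?_
        obtain ⟨hw, hK⟩ := isSuccess_iff.1 hp
        exact hw ▸ Language.append_mem_mul (h₁.mem_lang t ht) hK
      refine ⟨_, by rw [UniqueMatching.altTable, List.find?_append, find?_map_isSuccess,
        find?_map_isSuccess, hnone, hs]; rfl, ?_⟩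
      rintro (_ | ⟨_ | _, n⟩) u <;> simp [Assoc.altRight, hsV, hV.apply_nil, eq_comm]

open scoped Classical in
theorem catTable {P₁ P₂ : Pattern α} {T₁ T₂ : List (Success α)} (h₁ : IsTable B P₁ T₁)
    (h₂ : IsTable B P₂ T₂) : IsTable B (.cat P₁ P₂) (catTable T₁ T₂) where
  mem_lang := by
    simp only [UniqueMatching.catTable, List.mem_flatMap, List.mem_map, List.mem_filter]
    rintro _ ⟨t₁, ht₁, t₂, ⟨ht₂, -⟩, rfl⟩
    exact Language.append_mem_mul (h₁.mem_lang t₁ ht₁) (h₂.mem_lang t₂ ht₂)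
  find := by
    rintro K _ w₂ _ ⟨a, b, V₁, V₂, hV₁, hV₂, rfl, rfl⟩ hB
    rw [List.append_assoc] at hB ⊢
    have hB₂ : (b ++ w₂).length ≤ B := by rw [List.length_append] at hB; omega
    obtain ⟨s₁, hs₁, hsV₁⟩ := h₁.find hV₁ hB
    obtain ⟨s₂, hs₂, hsV₂⟩ := h₂.find hV₂ hB₂
    refine ⟨nodeBindings (a ++ b) s₁ s₂, find?_flatMap_eq hs₁ ?_ ?_, ?_⟩
    · rw [List.find?_map, List.find?_filter, show (fun t₂ : Success α => _) =
        isSuccess K (b ++ w₂) from ?_, hs₂]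
      · rfl
      · ext t₂
        grind [isSuccess]
    · rintro t₁ - _ ht hp
      obtain ⟨t₂, ht₂, rfl⟩ := List.mem_map.1 ht
      obtain ⟨ht₂, heq⟩ := List.mem_filter.1 ht₂
      obtain ⟨hw, hK⟩ := isSuccess_iff.1 hp
      rw [List.append_assoc, of_decide_eq_true heq] at hw
      refine isSuccess_iff.2 ⟨hw, ?_⟩
      exact of_decide_eq_true heq ▸ Language.append_mem_mul (h₂.mem_lang t₂ ht₂) hK
    · rintro (_ | ⟨_ | _, n⟩) u <;>
        simp [Assoc.cat, hsV₁, hsV₂, hV₁.apply_nil, hV₂.apply_nil, eq_comm]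

end IsTable

/-- The table of a pattern for words of length at most `B` over the listed letters. -/
noncomputable def Pattern.table (letters : List α) (B : ℕ) : Pattern α → List (Success α)
  | eps => leafTable (words letters B) [[]]
  | sym a => leafTable (words letters B) [[a]]
  | alt P₁ P₂ => altTable (P₁.table letters B) (P₂.table letters B)
  | cat P₁ P₂ => catTable (P₁.table letters B) (P₂.table letters B)
  | star P => starTable B (words letters B) (P.table letters B)

theorem isTable_table {letters : List α} (hl : ∀ a, a ∈ letters) (B : ℕ) (P : Pattern α) :
    IsTable B P (P.table letters B) := by
  induction P with
  | eps => exact isTable_eps fun w hw => (mem_words hl).2 hw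
  | sym a => exact isTable_sym a fun w hw => (mem_words hl).2 hw
  | alt P₁ P₂ h₁ h₂ => exact h₁.altTable h₂
  | cat P₁ P₂ h₁ h₂ => exact h₁.catTable h₂
  | star P h => exact h.starTable hl

/-- One step of the evaluation of `Pattern.table` on the prefix code of a pattern, read from right
to left; the stack `S` holds the tables of the subpatterns read so far. -/
noncomputable def tableStep (letters : List α) (B : ℕ) (S : List (List (Success α))) :
    Label α → List (List (Success α))
  | .star => starTable B (words letters B) S.headI :: S.tail
  | .cat => catTable S.headI S.tail.headI :: S.tail.tail
  | .alt => altTable S.headI S.tail.headI :: S.tail.tail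
  | .eps => leafTable (words letters B) [[]] :: S
  | .sym a => leafTable (words letters B) [[a]] :: S

theorem foldr_code (letters : List α) (B : ℕ) (P : Pattern α) (S : List (List (Success α))) :
    P.code.foldr (fun l S => tableStep letters B S l) S = P.table letters B :: S := by
  induction P generalizing S <;> simp_all [Pattern.code, Pattern.table, tableStep]

/-! ### Reading off an automaton -/

namespace FinAut

open scoped Classical in
/-- The states reached by reading `w`. -/
noncomputable def run (A : FinAut α) (w : List α) : List ℕ :=
  w.foldl (fun S a => (A.trans.filter fun t => t.2.1 = a ∧ t.1 ∈ S).map fun t => t.2.2) A.init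

theorem mem_run {A : FinAut α} {w : List α} {q : ℕ} : q ∈ A.run w ↔ q ∈ A.toNFA.eval w := by
  induction w using List.reverseRecOn generalizing q with
  | nil => rfl
  | append_singleton w a ih =>
    rw [NFA.eval_append_singleton, NFA.mem_stepSet]
    simp only [← ih]
    simp only [run, List.foldl_append, List.foldl_cons, List.foldl_nil, List.mem_map,
      List.mem_filter, decide_eq_true_eq, toNFA, Set.mem_ofPred_eq]
    constructor
    · rintro ⟨⟨p, b, r⟩, ⟨ht, rfl, hp⟩, rfl⟩
      exact ⟨p, hp, ht⟩
    · rintro ⟨p, hp, ht⟩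
      exact ⟨_, ⟨ht, rfl, hp⟩, rfl⟩

theorem mem_language {A : FinAut α} {w : List α} : w ∈ A.language ↔ ∃ q ∈ A.final, q ∈ A.run w := by
  simp only [mem_run]
  exact NFA.mem_accepts

/-- The states that can occur in a run. -/
def states (A : FinAut α) : List ℕ := A.init ++ A.trans.map fun t => t.2.2

/-- The automaton with the positions in the list of states as its states. -/
def finNFA (A : FinAut α) : NFA α (Fin A.states.length) where
  step i a := {j | (A.states[i], a, A.states[j]) ∈ A.trans}
  start := {i | A.states[i] ∈ A.init}
  accept := {i | A.states[i] ∈ A.final}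

theorem mem_eval_iff {A : FinAut α} {w : List α} {q : ℕ} :
    q ∈ A.toNFA.eval w ↔ ∃ i, A.states[i] = q ∧ i ∈ A.finNFA.eval w := by
  induction w using List.reverseRecOn generalizing q with
  | nil =>
    constructor
    · intro h
      obtain ⟨i, hi, rfl⟩ := List.mem_iff_getElem.1 (List.mem_append_left
        (A.trans.map fun t => t.2.2) (show q ∈ A.init from h))
      exact ⟨⟨i, hi⟩, rfl, h⟩
    · rintro ⟨i, rfl, h⟩
      exact h
  | append_singleton w a ih =>
    simp only [NFA.eval_append_singleton, NFA.mem_stepSet]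
    constructor
    · rintro ⟨p, hp, ht⟩
      obtain ⟨i, rfl, hi⟩ := ih.1 hp
      obtain ⟨j, hj, rfl⟩ := List.mem_iff_getElem.1 (List.mem_append_right
        A.init (List.mem_map_of_mem (f := fun t => t.2.2) ht))
      exact ⟨⟨j, hj⟩, rfl, i, hi, ht⟩
    · rintro ⟨j, rfl, i, hi, hj⟩
      exact ⟨_, ih.2 ⟨i, rfl, hi⟩, hj⟩

theorem finNFA_accepts (A : FinAut α) : A.finNFA.accepts = A.language := by
  ext w
  rw [NFA.mem_accepts, language, NFA.mem_accepts]
  constructor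
  · rintro ⟨i, hi, h⟩
    exact ⟨_, hi, mem_eval_iff.2 ⟨i, rfl, h⟩⟩
  · rintro ⟨q, hq, h⟩
    obtain ⟨i, rfl, hi⟩ := mem_eval_iff.1 h
    exact ⟨i, hq, hi⟩

end FinAut

/-- A bound for the number of colors that are needed for a type; `c` is the number of letters,
`q` the number of states and `k` the size of the pattern. -/
def numColors (c q k : ℕ) : ℕ := refineCard^[3 * k] ((c + 2) * (2 ^ q) ^ 2 ^ q)

theorem exists_coloring [Finite α] (A : FinAut α) : ∃ F : Coloring α, (∀ a, F.Respects {[a]}) ∧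
    F.Respects A.language ∧ ∀ k,
      Nat.card (F.level (3 * k)).κ = numColors (Nat.card α) A.states.length k := by
  refine ⟨Coloring.ofDFA A.finNFA.toDFA, Coloring.ofDFA_respects_singleton _, ?_, fun k => ?_⟩
  · rw [← FinAut.finNFA_accepts, ← NFA.toDFA_correct]
    exact Coloring.ofDFA_respects_accepts _
  · rw [Coloring.card_level, numColors]
    congr 1
    have := Fintype.ofFinite α
    have h : ∀ σ : Type, [Finite σ] → Nat.card (Option (Option α) × (Set σ → Set σ)) =
        (Nat.card α + 2) * (2 ^ Nat.card σ) ^ 2 ^ Nat.card σ := by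
      intro σ _
      have := Fintype.ofFinite σ
      classical
      simp
    exact (h (Fin A.states.length)).trans (by rw [Nat.card_fin])

theorem length_code (P : Pattern α) : P.code.length = P.size := by
  induction P <;> simp_all [Pattern.code, Pattern.size]

/-- The bound `numColors` for a pattern given by its code and a context given by an automaton. -/
def inputColors (letters : List α) (code : List (Label α)) (A : FinAut α) : ℕ :=
  numColors letters.length A.states.length code.length

open scoped Classical in
/-- The words bound to `n` by the first way in the table `T` to match all of `w`; there are none if
`w` is not matched, because the default value that `List.headI` then returns has no bindings. -/
noncomputable def boundWords (T : List (Success α)) (n : Node) (w : List α) : List (List α) :=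
  ((T.filter fun t => t.1 = w ∧ t.2.1 = []).headI.2.2.filter (·.1 = n)).map (·.2)

open scoped Classical in
theorem IsTable.mem_boundWords {B : ℕ} {P : Pattern α} {T : List (Success α)} (hT : IsTable B P T)
    {n : Node} {w u : List α} (hw : w.length ≤ B) :
    u ∈ boundWords T n w ↔ ∃ V, Parse P 1 w [] V ∧ V n = some u := by
  by_cases hP : w ∈ P.lang
  · obtain ⟨V, hV⟩ := exists_parse_one_iff.2 hP
    obtain ⟨s, hs, hsV⟩ := hT.find hV (by simpa using hw)
    have hfilter : ((T.filter fun t => t.1 = w ∧ t.2.1 = []).head?) = some (w, [], s) := by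
      rw [List.head?_filter, ← hs]
      congr 1
      ext t
      grind [isSuccess, Language.mem_one]
    obtain ⟨l, hl⟩ := List.head?_eq_some_iff.1 hfilter
    have hu : u ∈ boundWords T n w ↔ V n = some u := by
      rw [boundWords, hl, ← hsV]
      simp
    rw [hu]
    refine ⟨fun h => ⟨V, hV, h⟩, ?_⟩
    rintro ⟨V', hV', h⟩
    rwa [(hV.unique hV' rfl).2.2]
  · have hfilter : T.filter (fun t => t.1 = w ∧ t.2.1 = []) = [] := by
      simp only [List.filter_eq_nil_iff, decide_eq_true_eq]
      rintro t ht ⟨rfl, -⟩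
      exact hP (hT.mem_lang t ht)
    simp only [boundWords, hfilter]
    exact iff_of_false (List.not_mem_nil) fun ⟨V, hV, _⟩ => hP hV.mem.1

open scoped Classical in
/-- The words in the type of a node, relative to the language of `A`, that are bound when a word of
length at most `B` is matched. -/
noncomputable def typeWords (letters : List α) (B : ℕ) (code : List (Label α)) (n : Node)
    (A : FinAut α) : List (List α) :=
  let T := (code.foldr (fun l S => tableStep letters B S l) []).headI
  ((words letters B).filter fun w => ∃ q ∈ A.final, q ∈ A.run w).flatMap (boundWords T n)

theorem mem_typeWords {letters : List α} (hl : ∀ a, a ∈ letters) {B : ℕ} {P : Pattern α} {n : Node}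
    {A : FinAut α} {u : List α} : u ∈ typeWords letters B P.code n A ↔
      ∃ w ∈ A.language, w.length ≤ B ∧ ∃ V, Parse P 1 w [] V ∧ V n = some u := by
  simp only [typeWords, foldr_code, List.headI, List.mem_flatMap, List.mem_filter, mem_words hl,
    decide_eq_true_eq, ← FinAut.mem_language]
  constructor
  · rintro ⟨w, ⟨hw, hA⟩, hu⟩
    exact ⟨w, hA, hw, ((isTable_table hl B P).mem_boundWords hw).1 hu⟩
  · rintro ⟨w, hA, hw, hu⟩
    exact ⟨w, ⟨hw, hA⟩, ((isTable_table hl B P).mem_boundWords hw).2 hu⟩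

/-- The left quotients of `X` are reached by words of length at most `N`, and distinguished by words
of length at most `N`. -/
structure HasShortQuotients (X : Language α) (N : ℕ) : Prop where
  exists_short : ∀ w, ∃ x, x.length ≤ N ∧ X.leftQuotient x = X.leftQuotient w
  ext : ∀ ⦃x y⦄, (∀ v, v.length ≤ N → (x ++ v ∈ X ↔ y ++ v ∈ X)) →
    X.leftQuotient x = X.leftQuotient y

theorem Coloring.Respects.hasShortQuotients {F : Coloring α} {X : Language α} (hX : F.Respects X)
    {N : ℕ} (hN : Nat.card F.κ ≤ N) : HasShortQuotients X N := by
  have hX' : ∀ u v, F.color u = F.color v → (u ∈ X ↔ v ∈ X) :=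
    fun u v h => ⟨hX h, hX h.symm⟩
  refine ⟨fun w => ?_, fun x y h => ?_⟩
  · obtain ⟨x, hx, hN⟩ := F.exists_short hN w
    exact ⟨x, hN, Set.ext fun v => hX' _ _ (F.append hx rfl)⟩
  · ext v
    obtain ⟨v', hv, hN⟩ := F.exists_short hN v
    exact (hX' _ _ (F.append rfl hv)).symm.trans ((h v' hN).trans (hX' _ _ (F.append rfl hv)))

open scoped Classical in
/-- The words of length at most `N` that cannot be distinguished from `x` by appending words of
length at most `N`, where `T` lists the relevant words of the language. -/
noncomputable def shortEquivs (letters : List α) (N : ℕ) (T : List (List α)) (x : List α) :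
    List (List α) :=
  (words letters N).filter fun y => ∀ v ∈ words letters N, (x ++ v ∈ T ↔ y ++ v ∈ T)

open scoped Classical in
/-- An automaton for a language, read off from the list `T` of its short words: the states are (the
codes of) the words of length at most `N`, each standing for its left quotient. Several words may
stand for the same left quotient, which is why the automaton is nondeterministic. -/
noncomputable def quotientAut [Encodable α] (letters : List α) (N : ℕ) (T : List (List α)) :
    FinAut α where
  init := (shortEquivs letters N T []).map Encodable.encode
  final := ((words letters N).filter (· ∈ T)).map Encodable.encode
  trans := (words letters N).flatMap fun x => letters.flatMap fun a =>
    (shortEquivs letters N T (x ++ [a])).map fun y => (Encodable.encode x, a, Encodable.encode y)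

namespace HasShortQuotients

variable {X : Language α} {N : ℕ} {letters : List α} {T : List (List α)}

theorem mem_shortEquivs (hX : HasShortQuotients X N) (hl : ∀ a, a ∈ letters)
    (hT : ∀ w, w.length ≤ 2 * N + 1 → (w ∈ T ↔ w ∈ X)) {x y : List α} (hx : x.length ≤ N + 1) :
    y ∈ shortEquivs letters N T x ↔ y.length ≤ N ∧ X.leftQuotient x = X.leftQuotient y := by
  simp only [shortEquivs, List.mem_filter, mem_words hl, decide_eq_true_eq]
  refine and_congr_right fun hy => ?_
  have hT' : ∀ v : List α, v.length ≤ N → (x ++ v ∈ T ↔ x ++ v ∈ X) ∧ (y ++ v ∈ T ↔ y ++ v ∈ X) :=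
    fun v hv => ⟨hT _ (by simp; omega), hT _ (by simp; omega)⟩
  constructor
  · exact fun h => hX.ext fun v hv => by rw [← (hT' v hv).1, h v hv, (hT' v hv).2]
  · intro h v hv
    rw [(hT' v hv).1, (hT' v hv).2, ← Language.mem_leftQuotient, h, Language.mem_leftQuotient]

variable [Encodable α]

theorem mem_trans_quotientAut (hX : HasShortQuotients X N) (hl : ∀ a, a ∈ letters)
    (hT : ∀ w, w.length ≤ 2 * N + 1 → (w ∈ T ↔ w ∈ X)) {p q : ℕ} {a : α} :
    (p, a, q) ∈ (quotientAut letters N T).trans ↔ ∃ x y : List α, x.length ≤ N ∧ y.length ≤ N ∧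
      Encodable.encode x = p ∧ Encodable.encode y = q ∧
      X.leftQuotient (x ++ [a]) = X.leftQuotient y := by
  simp only [quotientAut, List.mem_flatMap, List.mem_map, mem_words hl, Prod.mk.injEq]
  constructor
  · rintro ⟨x, hx, b, -, y, hy, rfl, rfl, rfl⟩
    obtain ⟨hy, h⟩ := (hX.mem_shortEquivs hl hT (by simpa)).1 hy
    exact ⟨x, y, hx, hy, rfl, rfl, h⟩
  · rintro ⟨x, y, hx, hy, rfl, rfl, h⟩
    exact ⟨x, hx, a, hl a, y, (hX.mem_shortEquivs hl hT (by simpa)).2 ⟨hy, h⟩, rfl, rfl, rfl⟩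

theorem mem_eval_quotientAut (hX : HasShortQuotients X N) (hl : ∀ a, a ∈ letters)
    (hT : ∀ w, w.length ≤ 2 * N + 1 → (w ∈ T ↔ w ∈ X)) {q : ℕ} {w : List α} :
    q ∈ (quotientAut letters N T).toNFA.eval w ↔ ∃ x : List α, x.length ≤ N ∧
      Encodable.encode x = q ∧ X.leftQuotient w = X.leftQuotient x := by
  induction w using List.reverseRecOn generalizing q with
  | nil =>
    change q ∈ (shortEquivs letters N T []).map Encodable.encode ↔ _
    have hnil : ([] : List α).length ≤ N + 1 := Nat.zero_le _
    simp only [List.mem_map, hX.mem_shortEquivs hl hT hnil]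
    grind
  | append_singleton w a ih =>
    rw [NFA.eval_append_singleton, NFA.mem_stepSet]
    constructor
    · rintro ⟨p, hp, hq⟩
      obtain ⟨x, y, -, hy, rfl, rfl, hxy⟩ := (hX.mem_trans_quotientAut hl hT).1 hq
      obtain ⟨x', -, hx', hw⟩ := ih.1 hp
      obtain rfl := Encodable.encode_injective hx'
      exact ⟨y, hy, rfl, by rw [← hxy, Language.leftQuotient_append, hw,
        Language.leftQuotient_append]⟩
    · rintro ⟨y, hy, rfl, hw⟩
      obtain ⟨x, hx, hxw⟩ := hX.exists_short w
      refine ⟨_, ih.2 ⟨x, hx, rfl, hxw.symm⟩,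
        (hX.mem_trans_quotientAut hl hT).2 ⟨x, y, hx, hy, rfl, rfl, ?_⟩⟩
      rw [← hw, Language.leftQuotient_append, hxw, Language.leftQuotient_append]

theorem language_quotientAut (hX : HasShortQuotients X N) (hl : ∀ a, a ∈ letters)
    (hT : ∀ w, w.length ≤ 2 * N + 1 → (w ∈ T ↔ w ∈ X)) :
    (quotientAut letters N T).language = X := by
  have hfinal : ∀ x : List α, x.length ≤ N →
      (Encodable.encode x ∈ (quotientAut letters N T).final ↔ x ∈ X) := fun x hx => by
    simp [quotientAut, mem_words hl, hx, hT x (by omega)]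
  have hmem : ∀ {x w : List α}, X.leftQuotient w = X.leftQuotient x → (w ∈ X ↔ x ∈ X) :=
    fun {x w} h => by simpa using congrArg ([] ∈ ·) h
  ext w
  rw [FinAut.language, NFA.mem_accepts]
  constructor
  · rintro ⟨q, hq, hw⟩
    obtain ⟨x, hx, rfl, h⟩ := (hX.mem_eval_quotientAut hl hT).1 hw
    exact (hmem h).2 ((hfinal x hx).1 hq)
  · intro hw
    obtain ⟨x, hx, h⟩ := hX.exists_short w
    exact ⟨_, (hfinal x hx).2 ((hmem h).2 hw),
      (hX.mem_eval_quotientAut hl hT).2 ⟨x, hx, rfl, h.symm⟩⟩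

end HasShortQuotients

/-- The automaton for the type of a node of a pattern, which is given by its code. -/
noncomputable def typeAut [Encodable α] (letters : List α)
    (x : List (Label α) × Node × FinAut α) : FinAut α :=
  let N := inputColors letters x.1 x.2.2
  quotientAut letters N (typeWords letters (4 * N + 1) x.1 x.2.1 x.2.2)

theorem language_typeAut [Encodable α] [Finite α] {letters : List α} (hl : ∀ a, a ∈ letters)
    (hc : letters.length = Nat.card α) (P : Pattern α) (n : Node) (A : FinAut α) :
    (typeAut letters (P.code, n, A)).language = typeOf n P A.language := by
  obtain ⟨F, hF, hC, hcard⟩ := exists_coloring A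
  have hN : Nat.card (F.level (3 * P.size)).κ ≤ inputColors letters P.code A := by
    rw [hcard, inputColors, length_code, hc]
  refine ((Coloring.respects_typeOf hF hC P n).hasShortQuotients hN).language_quotientAut hl
    fun u hu => ?_
  rw [mem_typeWords hl]
  constructor
  · rintro ⟨w, hw, -, V, hV, hu⟩
    exact ⟨w, hw, V, match_iff_parse.2 hV, hu⟩
  · intro h
    obtain ⟨w, hw, hle, h⟩ := Coloring.exists_short_of_mem_typeOf hF hC hN h
    exact ⟨w, hw, hle.trans (by dsimp only; omega), h⟩

/-! ### Primitive recursiveness -/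

variable {β γ δ : Type*} [Primcodable β] [Primcodable γ] [Primcodable δ]

attribute [fun_prop] Primrec PrimrecPred Primrec.const Primrec.comp Primrec.fst Primrec.snd
  Primrec.pair Primrec.encode Primrec.list_length Primrec.list_tail Primrec.list_headI
  PrimrecPred.and

@[fun_prop]
theorem primrec_id : Primrec fun x : β => x :=
  Primrec.id

@[fun_prop]
theorem primrec_add {f g : β → ℕ} (hf : Primrec f) (hg : Primrec g) :
    Primrec fun x => f x + g x :=
  Primrec.nat_add.comp hf hg

@[fun_prop]
theorem primrec_mul {f g : β → ℕ} (hf : Primrec f) (hg : Primrec g) :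
    Primrec fun x => f x * g x :=
  Primrec.nat_mul.comp hf hg

@[fun_prop]
theorem primrec_iterate {n : β → ℕ} {c : β → γ} {f : β → γ → γ} (hn : Primrec n) (hc : Primrec c)
    (hf : Primrec fun x : β × γ => f x.1 x.2) : Primrec fun x => (f x)^[n x] (c x) :=
  Primrec.nat_iterate hn hc hf

@[fun_prop]
theorem primrec_pow {f g : β → ℕ} (hf : Primrec f) (hg : Primrec g) :
    Primrec fun x => f x ^ g x := by
  have h : Primrec fun x => (f x * ·)^[g x] 1 := by fun_prop
  exact h.of_eq fun x => by simp

@[fun_prop]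
theorem primrec_cons {f : β → γ} {l : β → List γ} (hf : Primrec f) (hl : Primrec l) :
    Primrec fun x => f x :: l x :=
  Primrec.list_cons.comp hf hl

@[fun_prop]
theorem primrec_append {f g : β → List γ} (hf : Primrec f) (hg : Primrec g) :
    Primrec fun x => f x ++ g x :=
  Primrec.list_append.comp hf hg

@[fun_prop]
theorem primrec_map {l : β → List γ} {f : β → γ → δ} (hl : Primrec l)
    (hf : Primrec fun x : β × γ => f x.1 x.2) : Primrec fun x => (l x).map (f x) :=
  Primrec.list_map hl hf

@[fun_prop]
theorem primrec_flatMap {l : β → List γ} {f : β → γ → List δ} (hl : Primrec l)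
    (hf : Primrec fun x : β × γ => f x.1 x.2) : Primrec fun x => (l x).flatMap (f x) :=
  Primrec.list_flatMap hl hf

@[fun_prop]
theorem primrec_foldl {l : β → List γ} {c : β → δ} {f : β → δ → γ → δ} (hl : Primrec l)
    (hc : Primrec c) (hf : Primrec fun x : β × δ × γ => f x.1 x.2.1 x.2.2) :
    Primrec fun x => (l x).foldl (f x) (c x) :=
  Primrec.list_foldl (h := fun x p => f x p.1 p.2) hl hc hf

@[fun_prop]
theorem primrec_foldr {l : β → List γ} {c : β → δ} {f : β → γ → δ → δ} (hl : Primrec l)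
    (hc : Primrec c) (hf : Primrec fun x : β × γ × δ => f x.1 x.2.1 x.2.2) :
    Primrec fun x => (l x).foldr (f x) (c x) :=
  Primrec.list_foldr (h := fun x p => f x p.1 p.2) hl hc hf

theorem primrecRel_swap {p : β → γ → Prop} (hp : PrimrecPred fun x : β × γ => p x.1 x.2) :
    PrimrecRel fun y x => p x y :=
  (hp.comp (Primrec.snd.pair Primrec.fst) : PrimrecPred fun z : γ × β => p z.2 z.1)

@[fun_prop]
theorem primrec_filter {l : β → List γ} {p : β → γ → Prop} [∀ x, DecidablePred (p x)]
    (hl : Primrec l) (hp : PrimrecPred fun x : β × γ => p x.1 x.2) :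
    Primrec fun x => (l x).filter fun y => p x y := by
  classical
  refine ((primrecRel_swap hp).listFilter.comp hl Primrec.id).of_eq fun x => ?_
  congr

@[fun_prop]
theorem primrecPred_eq {f g : β → γ} (hf : Primrec f) (hg : Primrec g) :
    PrimrecPred fun x => f x = g x :=
  Primrec.eq.comp hf hg

@[fun_prop]
theorem primrecPred_iff {p q : β → Prop} (hp : PrimrecPred p) (hq : PrimrecPred q) :
    PrimrecPred fun x => (p x ↔ q x) :=
  ((hp.and hq).or (hp.not.and hq.not)).of_eq fun x => by tauto

@[fun_prop]
theorem primrecPred_exists_mem {l : β → List γ} {p : β → γ → Prop} (hl : Primrec l)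
    (hp : PrimrecPred fun x : β × γ => p x.1 x.2) : PrimrecPred fun x => ∃ y ∈ l x, p x y :=
  (primrecRel_swap hp).exists_mem_list.comp hl Primrec.id

@[fun_prop]
theorem primrecPred_forall_mem {l : β → List γ} {p : β → γ → Prop} (hl : Primrec l)
    (hp : PrimrecPred fun x : β × γ => p x.1 x.2) : PrimrecPred fun x => ∀ y ∈ l x, p x y :=
  (primrecRel_swap hp).forall_mem_list.comp hl Primrec.id

@[fun_prop]
theorem primrecPred_mem {f : β → γ} {l : β → List γ} (hf : Primrec f) (hl : Primrec l) :
    PrimrecPred fun x => f x ∈ l x := by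
  have h : PrimrecPred fun x => ∃ y ∈ l x, y = f x := by fun_prop
  exact h.of_eq fun x => by simp

variable [Primcodable α]

@[fun_prop]
theorem primrec_words (letters : List α) {n : β → ℕ} (hn : Primrec n) :
    Primrec fun x => words letters (n x) := by
  have h : Primrec fun x => (fun S : List (List α) =>
      S.flatMap (fun w => letters.map (· :: w)) ++ [[]])^[n x] [[]] := by fun_prop
  refine h.of_eq fun x => ?_
  induction n x with
  | zero => rfl
  | succ n ih => rw [Function.iterate_succ_apply', ih, words]

@[fun_prop]
theorem primrec_concatWords {L : β → List (List α)} {k : β → ℕ} (hL : Primrec L)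
    (hk : Primrec k) : Primrec fun x => concatWords (L x) (k x) := by
  unfold concatWords
  fun_prop

@[fun_prop]
theorem primrec_nodeBindings {w : β → List α} {s₁ s₂ : β → List (Node × List α)} (hw : Primrec w)
    (h₁ : Primrec s₁) (h₂ : Primrec s₂) : Primrec fun x => nodeBindings (w x) (s₁ x) (s₂ x) := by
  unfold nodeBindings
  fun_prop

@[fun_prop]
theorem primrec_leafTable {U S : β → List (List α)} (hU : Primrec U) (hS : Primrec S) :
    Primrec fun x => leafTable (U x) (S x) := by
  unfold leafTable
  fun_prop

@[fun_prop]
theorem primrec_altTable {T₁ T₂ : β → List (Success α)} (h₁ : Primrec T₁) (h₂ : Primrec T₂) :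
    Primrec fun x => altTable (T₁ x) (T₂ x) := by
  unfold altTable
  fun_prop

@[fun_prop]
theorem primrec_catTable {T₁ T₂ : β → List (Success α)} (h₁ : Primrec T₁) (h₂ : Primrec T₂) :
    Primrec fun x => catTable (T₁ x) (T₂ x) := by
  unfold catTable
  fun_prop

@[fun_prop]
theorem primrec_starTable {B : β → ℕ} {U : β → List (List α)} {T : β → List (Success α)}
    (hB : Primrec B) (hU : Primrec U) (hT : Primrec T) :
    Primrec fun x => starTable (B x) (U x) (T x) := by
  unfold starTable
  fun_prop

theorem primrec_label_casesOn {l : β → Label α} {f₁ f₂ f₃ f₄ : β → γ} {g : β → α → γ}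
    (hl : Primrec l) (h₁ : Primrec f₁) (h₂ : Primrec f₂) (h₃ : Primrec f₃) (h₄ : Primrec f₄)
    (hg : Primrec fun x : β × α => g x.1 x.2) :
    Primrec fun x => (Label.casesOn (l x) (f₁ x) (f₂ x) (f₃ x) (f₄ x) (g x) : γ) := by
  have hf : Primrec₂ fun (x : β) (i : Fin 4) =>
      if i = 0 then f₁ x else if i = 1 then f₂ x else if i = 2 then f₃ x else f₄ x := by
    refine Primrec.ite ?_ ?_ (Primrec.ite ?_ ?_ (Primrec.ite ?_ ?_ ?_)) <;> fun_prop
  refine (Primrec.sumCasesOn ((Primrec.of_equiv (e := Label.equivSum α)).comp hl) hf hg).of_eq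
    fun x => ?_
  cases l x <;> rfl

@[fun_prop]
theorem primrec_tableStep (letters : List α) {B : β → ℕ} {S : β → List (List (Success α))}
    {l : β → Label α} (hB : Primrec B) (hS : Primrec S) (hl : Primrec l) :
    Primrec fun x => tableStep letters (B x) (S x) (l x) := by
  refine (primrec_label_casesOn
    (f₁ := fun x => starTable (B x) (words letters (B x)) (S x).headI :: (S x).tail)
    (f₂ := fun x => catTable (S x).headI (S x).tail.headI :: (S x).tail.tail)
    (f₃ := fun x => altTable (S x).headI (S x).tail.headI :: (S x).tail.tail)
    (f₄ := fun x => leafTable (words letters (B x)) [[]] :: S x)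
    (g := fun x a => leafTable (words letters (B x)) [[a]] :: S x)
    hl ?_ ?_ ?_ ?_ ?_).of_eq fun x => by cases l x <;> rfl
  all_goals fun_prop

@[fun_prop]
theorem primrec_finAut_init : Primrec (FinAut.init : FinAut α → List ℕ) :=
  Primrec.fst.comp (Primrec.of_equiv (e := FinAut.equivProd α))

@[fun_prop]
theorem primrec_finAut_final : Primrec (FinAut.final : FinAut α → List ℕ) :=
  (Primrec.fst.comp Primrec.snd).comp (Primrec.of_equiv (e := FinAut.equivProd α))

@[fun_prop]
theorem primrec_finAut_trans : Primrec (FinAut.trans : FinAut α → List (ℕ × α × ℕ)) :=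
  (Primrec.snd.comp Primrec.snd).comp (Primrec.of_equiv (e := FinAut.equivProd α))

@[fun_prop]
theorem primrec_finAut_mk {I F : β → List ℕ} {T : β → List (ℕ × α × ℕ)} (hI : Primrec I)
    (hF : Primrec F) (hT : Primrec T) : Primrec fun x => (⟨I x, F x, T x⟩ : FinAut α) :=
  (Primrec.of_equiv_symm (e := FinAut.equivProd α)).comp (hI.pair (hF.pair hT))

@[fun_prop]
theorem primrec_run {A : β → FinAut α} {w : β → List α} (hA : Primrec A) (hw : Primrec w) :
    Primrec fun x => (A x).run (w x) := by
  unfold FinAut.run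
  fun_prop

@[fun_prop]
theorem primrec_inputColors (letters : List α) {c : β → List (Label α)} {A : β → FinAut α}
    (hc : Primrec c) (hA : Primrec A) : Primrec fun x => inputColors letters (c x) (A x) := by
  unfold inputColors numColors refineCard FinAut.states
  fun_prop

@[fun_prop]
theorem primrec_boundWords {T : β → List (Success α)} {n : β → Node} {w : β → List α}
    (hT : Primrec T) (hn : Primrec n) (hw : Primrec w) :
    Primrec fun x => boundWords (T x) (n x) (w x) := by
  unfold boundWords
  fun_prop

@[fun_prop]
theorem primrec_typeWords (letters : List α) {B : β → ℕ} {c : β → List (Label α)} {n : β → Node}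
    {A : β → FinAut α} (hB : Primrec B) (hc : Primrec c) (hn : Primrec n) (hA : Primrec A) :
    Primrec fun x => typeWords letters (B x) (c x) (n x) (A x) := by
  unfold typeWords
  fun_prop

@[fun_prop]
theorem primrec_shortEquivs (letters : List α) {N : β → ℕ} {T : β → List (List α)}
    {w : β → List α} (hN : Primrec N) (hT : Primrec T) (hw : Primrec w) :
    Primrec fun x => shortEquivs letters (N x) (T x) (w x) := by
  unfold shortEquivs
  fun_prop

@[fun_prop]
theorem primrec_quotientAut (letters : List α) {N : β → ℕ} {T : β → List (List α)}
    (hN : Primrec N) (hT : Primrec T) :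
    Primrec fun x => quotientAut letters (N x) (T x) := by
  unfold quotientAut
  fun_prop

theorem primrec_typeAut (letters : List α) : Primrec (typeAut letters) := by
  unfold typeAut
  fun_prop

end UniqueMatching

theorem theorem2 {α : Type*} [Finite α] [Primcodable α] :
    (∀ (P : UniqueMatching.Pattern α) (n : UniqueMatching.Node), n ∈ P.bn →
      ∀ C : Language α, C.IsRegular → (UniqueMatching.typeOf n P C).IsRegular) ∧
    (∃ f : List (UniqueMatching.Label α) × UniqueMatching.Node × UniqueMatching.FinAut α →
        UniqueMatching.FinAut α,
      Computable f ∧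
      ∀ (P : UniqueMatching.Pattern α) (n : UniqueMatching.Node) (A : UniqueMatching.FinAut α),
        n ∈ P.bn →
        (f (P.code, n, A)).language = UniqueMatching.typeOf n P A.language) := by
  refine ⟨fun P n _ C hC => UniqueMatching.isRegular_typeOf P n hC, ?_⟩
  have := Fintype.ofFinite α
  refine ⟨_, (UniqueMatching.primrec_typeAut (Finset.univ : Finset α).toList).to_comp,
    fun P n A _ => UniqueMatching.language_typeAut (by simp) (by simp) P n A⟩
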